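/- Let $G=(V,E,m,w)$ be an infinite weighted graph: $(V,E)$ is an infinite, connected, locally finite, simple, undirected graph, with edge weights $w_{xy}=w_{yx}>0$ for $x\sim y$ (and $w_{xy}=0$ otherwise) and vertex weights $m_x>0$. Let $|\Omega|=\sum_{x\in\Omega}m_x$, let $\Delta f(x)=\sum_y\frac{w_{xy}}{m_x}(f(y)-f(x))$, and let $\mu_e(G)\in(-\infty,\infty]$ be the bottom of the essential spectrum of the self-adjoint operator $-\Delta$ on $\ell^2(V,m)$ associated with the closure of the form $\frac12\sum_{x,y}w_{xy}|f(x)-f(y)|^2$ on finitely supported functions ($\mu_e(G)=\infty$ if the essential spectrum is empty). Let $d$ be the combinatorial distance. Let $\rho$ be an intrinsic (pseudo) metric on $G$, i.e. $\sum_y w_{xy}\rho(x,y)^2\le m_x$ for all $x$, such that all balls $B_R(x)=\{y:\rho(y,x)\le R\}$, $R>0$, are finite and the jump size $s=\sup_{x\sim y}\rho(x,y)$ is finite. Define $$a_0(t)=\begin{cases}\frac1s\log\bigl(1+s\sqrt{2t}\bigr),\ t\in(0,\infty), & \rho\ne d,\\[2pt] \log\frac1{1-t}+\log\bigl(1+\sqrt{1-(1-t)^2}\bigr),\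 t\in(0,1), & \rho=d.\end{cases}$$ This is an increasing bijection of its domain onto $(0,\infty)$; let $a_0^{-1}$ be its inverse, extended by $a_0^{-1}(\infty)=\lim_{y\to\infty}a_0^{-1}(y)$, which is $\infty$ if $\rho\neq d$ and $1$ if $\rho=d$. Fix $x_0\in V$ and let $$\widetilde\tau(G)=\begin{cases}\liminf_{R\to\infty}\frac1R\log|B_R(x_0)|, & |V|=\infty,\\ \liminf_{R\to\infty}\bigl(-\frac1R\log|V\setminus B_R(x_0)|\bigr), & |V|<\infty.\end{cases}$$ Suppose $\mu_e(G)>0$. Then for every real $t$ with $0<t<\mu_e(G)$ (that is, if $\mu_e(G)<\infty$, for every $t=\mu_e(G)-\epsilon$ with $0<\epsilon<\mu_e(G)$), $t$ lies in the domain of $a_0$, and with $a=a_0(t)$ there is a constant $C>0$, independent of $R$, such that for all sufficiently large $R$ $$|B_R(x_0)|\ge Ce^{2aR}\ \text{ if } |V|=\infty,\qquad |V\setminus B_R(x_0)|\le Ce^{-2aR}\ \text{ if } |V|<\infty.$$ Consequently $\widetilde\tau(G)>0$ and $$\mu_e(G)\le a_0^{-1}\Bigl(\frac{\widetilde\tau(G)}2\Bigr).$$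 Moreover, if $G$ is the $N$-regular tree, $N\ge3$, with $w_{xy}=1$ for $x\sim y$ and $m_x=N$, and $\rho=d$, then $\mu_e(G)=1-\frac{2\sqrt{N-1}}N$, $\widetilde\tau(G)=\log(N-1)$, and equality holds: $\mu_e(G)=a_0^{-1}(\widetilde\tau(G)/2)$. -/

import Mathlib

open Filter Topology
open scoped ENNReal

/-- A weighted graph `G = (V, E, m, w)`: a locally finite, simple, undirected, connected graph with
positive symmetric edge weights `w` (extended by `0` to non-adjacent pairs) and positive vertex
weights `m`. -/
structure WeightedGraph (V : Type*) where
  graph : SimpleGraph V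
  finite_neighborSet : ∀ x, (graph.neighborSet x).Finite
  connected : graph.Connected
  w : V → V → ℝ
  w_symm : ∀ x y, w x y = w y x
  w_pos : ∀ x y, graph.Adj x y → 0 < w x y
  w_zero : ∀ x y, ¬ graph.Adj x y → w x y = 0
  m : V → ℝ
  m_pos : ∀ x, 0 < m x

namespace WeightedGraph

variable {V : Type*} (G : WeightedGraph V)

/-- The combinatorial distance `d`. -/
noncomputable def combDist (x y : V) : ℝ := (G.graph.dist x y : ℝ)

/-- The `m`-measure `|Ω|` of a set of vertices. -/
noncomputable def vol (Ω : Set V) : ℝ≥0∞ := ∑' x : Ω, ENNReal.ofReal (G.m x)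

/-- The Laplace operator `Δf(x) = ∑_y (w_xy / m_x) (f(y) - f(x))`; by local finiteness the sum has
only finitely many nonzero terms. -/
noncomputable def laplacian (f : V → ℝ) (x : V) : ℝ := ∑' y, G.w x y / G.m x * (f y - f x)

/-! ### The Laplacian as a self-adjoint operator on `ℓ²(V, m)`, and its essential spectrum -/

/-- The squared norm of `ℓ²(V, m)`, with value `∞` outside `ℓ²(V, m)`. -/
noncomputable def normSq (f : V → ℝ) : ℝ≥0∞ := ∑' x, ENNReal.ofReal (G.m x * f x ^ 2)

/-- Membership in the real Hilbert space `ℓ²(V, m)`. -/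
def MemL2 (f : V → ℝ) : Prop := G.normSq f < ∞

/-- The Dirichlet energy `½ ∑_{x,y} w_xy |f(x) - f(y)|²`, in `[0, ∞]`. -/
noncomputable def energy (f : V → ℝ) : ℝ≥0∞ :=
  (∑' x, ∑' y, ENNReal.ofReal (G.w x y * (f x - f y) ^ 2)) / 2

/-- The form domain: the closure of the finitely supported functions `C₀(V)` with respect to the
form norm `(‖f‖² + energy f)^{1/2}`. -/
def MemFormDomain (f : V → ℝ) : Prop :=
  ∃ φ : ℕ → V → ℝ, (∀ n, (Function.support (φ n)).Finite) ∧
    Tendsto (fun n => G.normSq (f - φ n)) atTop (𝓝 0) ∧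
    Tendsto (fun n => G.energy (f - φ n)) atTop (𝓝 0)

/-- The domain of the self-adjoint operator `-Δ` on `ℓ²(V, m)` that is associated with the closure
of the energy form on `C₀(V)` (the Friedrichs extension of `-Δ` on `C₀(V)`). By Green's formula
`energy(f, φ) = ⟨-Δf, φ⟩` for `φ ∈ C₀(V)`, this domain consists of those `f` in the form domain for
which `Δf` is in `ℓ²(V, m)`, and the operator acts as `f ↦ -Δf`. -/
def MemDomain (f : V → ℝ) : Prop := G.MemFormDomain f ∧ G.MemL2 (G.laplacian f)

/-- The resolvent set: `-Δ - t` maps the domain bijectively onto `ℓ²(V, m)`, with bounded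
inverse. -/
def resolventSet : Set ℝ :=
  {t | (∀ g, G.MemL2 g → ∃! f, G.MemDomain f ∧ -G.laplacian f - t • f = g) ∧
    ∃ C : NNReal, ∀ f, G.MemDomain f →
      G.normSq f ≤ C * G.normSq (-G.laplacian f - t • f)}

/-- The spectrum of `-Δ` (which is real, as `-Δ` is self-adjoint). -/
def laplacianSpectrum : Set ℝ := (G.resolventSet)ᶜ

/-- The eigenspace of `-Δ` for the value `t`. (The span does not add any function.) -/
def eigenspace (t : ℝ) : Submodule ℝ (V → ℝ) :=
  Submodule.span ℝ {f | G.MemDomain f ∧ -G.laplacian f = t • f}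

/-- The discrete spectrum: isolated points of the spectrum that are eigenvalues of finite
multiplicity. -/
def discreteSpectrum : Set ℝ :=
  {t | t ∈ G.laplacianSpectrum ∧
    (∃ δ > 0, ∀ u ∈ G.laplacianSpectrum, |u - t| < δ → u = t) ∧
    G.eigenspace t ≠ ⊥ ∧ FiniteDimensional ℝ (G.eigenspace t)}

/-- The essential spectrum. -/
def essentialSpectrum : Set ℝ := G.laplacianSpectrum \ G.discreteSpectrum

/-- `μ_e(G)`, the bottom of the essential spectrum (`+∞` if the essential spectrum is empty). -/
noncomputable def muE : EReal := sInf ((fun t : ℝ => (t : EReal)) '' G.essentialSpectrum)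

/-! ### Intrinsic metrics -/

/-- The set of the values `ρ(x, y)` over all edges. -/
def edgeLengths (ρ : V → V → ℝ) : Set ℝ := {t | ∃ x y, G.graph.Adj x y ∧ t = ρ x y}

/-- The jump size `s = sup_{x ∼ y} ρ(x, y)`. -/
noncomputable def jumpSize (ρ : V → V → ℝ) : ℝ := sSup (G.edgeLengths ρ)

/-- The ball `B_R(x)`. -/
def ball (ρ : V → V → ℝ) (x : V) (R : ℝ) : Set V := {y | ρ y x ≤ R}

/-- `ρ` is an intrinsic (pseudo) metric with finite balls and finite jump size. -/
structure IsAdmissible (ρ : V → V → ℝ) : Prop where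
  nonneg : ∀ x y, 0 ≤ ρ x y
  self : ∀ x, ρ x x = 0
  symm : ∀ x y, ρ x y = ρ y x
  triangle : ∀ x y z, ρ x z ≤ ρ x y + ρ y z
  intrinsic : ∀ x, ∑' y, G.w x y * ρ x y ^ 2 ≤ G.m x
  finite_ball : ∀ x R, 0 < R → (ball ρ x R).Finite
  finite_jump : BddAbove (G.edgeLengths ρ)

open Classical in
/-- The function `a_μ(t)`; it depends on whether `ρ` is the combinatorial distance. -/
noncomputable def rate (ρ : V → V → ℝ) (μ t : ℝ) : ℝ :=
  if ρ = G.combDist then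
    Real.log ((1 - μ) / (1 - t)) + Real.log (1 + √(1 - ((1 - t) / (1 - μ)) ^ 2))
  else 1 / G.jumpSize ρ * Real.log (1 + G.jumpSize ρ * √(2 * (t - μ)))

/-- The domain of `a_μ`: the interval `(μ, 1)` if `ρ = d`, and `(μ, ∞)` otherwise. -/
def rateDomain (ρ : V → V → ℝ) (μ : ℝ) : Set ℝ := {t | μ < t ∧ (ρ = G.combDist → t < 1)}

/-- `a_0` is a bijection from its domain onto `(0, ∞)`. -/
theorem rate_bijOn (ρ : V → V → ℝ) (hs : 0 < G.jumpSize ρ) :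
    Set.BijOn (G.rate ρ 0) (G.rateDomain ρ 0) (Set.Ioi 0) := by
  classical
  set s := G.jumpSize ρ with hsdef
  by_cases hρ : ρ = G.combDist
  · have hf : ∀ t, G.rate ρ 0 t = Real.log (1 / (1 - t)) + Real.log (1 + √(1 - (1 - t) ^ 2)) := by
      intro t; simp [rate, hρ]
    have hlog : ∀ t, t < 1 →
        G.rate ρ 0 t = Real.log ((1 + √(1 - (1 - t) ^ 2)) / (1 - t)) := by
      intro t ht
      have h1 : 0 < 1 - t := by linarith
      rw [hf, ← Real.log_mul (by positivity) (by positivity)]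
      congr 1
      field_simp
    refine Set.InvOn.bijOn (f' := fun y => (Real.exp y - 1) ^ 2 / (1 + Real.exp y ^ 2))
      ⟨?_, ?_⟩ ?_ ?_
    · rintro t ⟨ht0, ht1⟩
      have ht1 := ht1 hρ
      have h1 : 0 < 1 - t := by linarith
      have hr : √(1 - (1 - t) ^ 2) ^ 2 = 1 - (1 - t) ^ 2 := Real.sq_sqrt (by nlinarith)
      have hr0 := Real.sqrt_nonneg (1 - (1 - t) ^ 2)
      simp only [hlog t ht1]
      rw [Real.exp_log (by positivity)]
      set r := √(1 - (1 - t) ^ 2)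
      have hne : (1 - t) ≠ 0 := h1.ne'
      have hd : (1 - t) ^ 2 + (1 + r) ^ 2 ≠ 0 := by positivity
      have h2 : ((1 + r) / (1 - t) - 1) ^ 2 / (1 + ((1 + r) / (1 - t)) ^ 2) =
          (1 + r - (1 - t)) ^ 2 / ((1 - t) ^ 2 + (1 + r) ^ 2) := by
        generalize 1 - t = u at *
        field_simp
      rw [h2, div_eq_iff hd]
      linear_combination (1 - t) * hr
    · intro y hy
      have hy : 0 < y := hy
      have hE : 1 < Real.exp y := Real.one_lt_exp_iff.2 hy
      have hlt : (Real.exp y - 1) ^ 2 / (1 + Real.exp y ^ 2) < 1 := by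
        rw [div_lt_one (by positivity)]; nlinarith
      simp only [hlog _ hlt]
      set E := Real.exp y with hEdef
      have hu : 1 - (E - 1) ^ 2 / (1 + E ^ 2) = 2 * E / (1 + E ^ 2) := by field_simp; ring
      have hsq : 1 - (2 * E / (1 + E ^ 2)) ^ 2 = ((E ^ 2 - 1) / (1 + E ^ 2)) ^ 2 := by
        field_simp; ring
      rw [hu, hsq, Real.sqrt_sq (div_nonneg (by nlinarith) (by positivity))]
      have : (1 + (E ^ 2 - 1) / (1 + E ^ 2)) / (2 * E / (1 + E ^ 2)) = E := by
        field_simp; ring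
      rw [this, hEdef, Real.log_exp]
    · rintro t ⟨ht0, ht1⟩
      have ht1 := ht1 hρ
      have h1 : 0 < 1 - t := by linarith
      have hr0 := Real.sqrt_nonneg (1 - (1 - t) ^ 2)
      rw [Set.mem_Ioi, hlog t ht1]
      apply Real.log_pos
      rw [one_lt_div h1]
      linarith
    · intro y hy
      have hy : 0 < y := hy
      have hE : 1 < Real.exp y := Real.one_lt_exp_iff.2 hy
      have h0 : 0 < Real.exp y - 1 := by linarith
      refine ⟨by positivity, fun _ => ?_⟩
      rw [div_lt_one (by positivity)]; nlinarith
  · have hf : ∀ t, G.rate ρ 0 t = 1 / s * Real.log (1 + s * √(2 * t)) := by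
      intro t; simp [rate, hρ, hsdef]
    refine Set.InvOn.bijOn (f' := fun y => (Real.exp (s * y) - 1) ^ 2 / (2 * s ^ 2))
      ⟨?_, ?_⟩ ?_ ?_
    · rintro t ⟨ht0, -⟩
      have hr : √(2 * t) ^ 2 = 2 * t := Real.sq_sqrt (by linarith)
      simp only [hf]
      rw [← mul_assoc, mul_one_div_cancel hs.ne', one_mul, Real.exp_log (by positivity)]
      rw [div_eq_iff (by positivity)]
      linear_combination s ^ 2 * hr
    · intro y hy
      have hy : 0 < y := hy
      have hE : 1 < Real.exp (s * y) := Real.one_lt_exp_iff.2 (by positivity)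
      simp only [hf]
      have : 2 * ((Real.exp (s * y) - 1) ^ 2 / (2 * s ^ 2)) = ((Real.exp (s * y) - 1) / s) ^ 2 := by
        field_simp
      rw [this, Real.sqrt_sq (div_nonneg (by linarith) hs.le), mul_div_cancel₀ _ hs.ne',
        add_sub_cancel, Real.log_exp]
      field_simp
    · rintro t ⟨ht0, -⟩
      have h2 : 0 < √(2 * t) := Real.sqrt_pos.2 (by linarith)
      rw [Set.mem_Ioi, hf]
      have := Real.log_pos (x := 1 + s * √(2 * t)) (by have := mul_pos hs h2; linarith)
      positivity
    · intro y hy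
      have hy : 0 < y := hy
      have hE : 1 < Real.exp (s * y) := Real.one_lt_exp_iff.2 (by positivity)
      have h0 : 0 < Real.exp (s * y) - 1 := by linarith
      exact ⟨by positivity, fun h => absurd h hρ⟩

open Classical in
/-- The inverse function `a_0⁻¹` on `(0, ∞]`, where `a_0⁻¹(∞)` is the supremum of the domain of
`a_0` (that is, `1` if `ρ = d` and `∞` otherwise), which is the limit of `a_0⁻¹(y)` as `y → ∞`. -/
noncomputable def rateInv (ρ : V → V → ℝ) (y : EReal) : EReal :=
  if y = ⊤ then sSup ((fun t : ℝ => (t : EReal)) '' G.rateDomain ρ 0)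
  else ((Function.invFunOn (G.rate ρ 0) (G.rateDomain ρ 0) y.toReal : ℝ) : EReal)

open Classical in
/-- The (modified) volume entropy, defined with the limit inferior. -/
noncomputable def entropy (ρ : V → V → ℝ) (x₀ : V) : EReal :=
  if G.vol Set.univ = ∞ then
    liminf (fun R : ℝ => ((1 / R * Real.log (G.vol (ball ρ x₀ R)).toReal : ℝ) : EReal)) atTop
  else
    liminf (fun R : ℝ => ((-(1 / R * Real.log (G.vol (ball ρ x₀ R)ᶜ).toReal) : ℝ) : EReal)) atTop

/-- `G` is the `N`-regular tree with the standard weights `w = 1` on edges and `m = N`. -/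
structure IsRegularTree (N : ℕ) : Prop where
  isTree : G.graph.IsTree
  regular : ∀ x, (G.graph.neighborSet x).ncard = N
  w_eq : ∀ x y, G.graph.Adj x y → G.w x y = 1
  m_eq : ∀ x, G.m x = N

end WeightedGraph

/-! ### Bounded self-adjoint operators on a real Hilbert space: positivity of polynomials. -/

section BoundedOperators

open Polynomial
open scoped InnerProductSpace

variable {H : Type*} [NormedAddCommGroup H] [InnerProductSpace ℝ H]

/-! The growth estimates come from playing a lower bound of the form against exponential test
functions.

Lower bound: below `μ_e` the spectrum is discrete, so `-Δ` lies above any level `t' < μ_e` up to a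
finite-rank error. A finite-rank projection on `ℓ²` is, up to a small multiple of the norm,
controlled by finitely many coordinates. Hence for `0 < t < μ_e` there are `t' > t`, a finite set
`K` and `C` with `t' ‖f‖² ≤ energy f + C ∑_K m f²` for finitely supported `f` (`exists_form_bound`).
To stay with bounded operators, the spectral part is carried out for the resolvent `(1 - Δ)⁻¹ = J
J*`, where `J` embeds the form domain into `ℓ²`; the level `t` becomes `1 / (1 + t)`, and
polynomials of the operator replace a spectral measure
(`IsSelfAdjoint.exists_finiteDimensional_inner_le`).

Upper bound: `a = a_0(t)` is made so that `u = e^φ` satisfies `(u x - u y)² ≤ t ρ² (u x² + u y²)` on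
edges when `φ` is `a`-Lipschitz for `ρ` (`exp_sub_exp_sq_le`). As `ρ` is intrinsic, such a `u` has
energy at most `t ‖u‖²` (`energy_le`). The gap `t' - t` leaves only the term on `K` and the error of
cutting `u` off.

In infinite volume, `u` equals 1 near `x₀` and decays like `e^{-aρ}`. Its mass near `x₀` outweighs
the term on `K`, so the cutoff error, of order `e^{-2aR} |B_R|`, cannot be small. In finite volume,
`u = e^{a min(ρ, R)}` is in `ℓ²` with norm bounded uniformly in `R`, while `u = e^{aR}` off `B_R`.
So `2 a_0(t)` is at most the entropy for all `t < μ_e`, and inverting `a_0` gives the bound on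
`μ_e`.

For the regular tree, the positive function `(N-1)^{-d/2}` bounds `μ_e` from below and counting
bounds the entropy from above. The general inequality joins these two bounds into a chain whose ends
agree. -/

theorem ContinuousLinearMap.IsPositive.inner_sq_le {S : H →L[ℝ] H} (hS : S.IsPositive) (x y : H) :
    ⟪S x, y⟫_ℝ ^ 2 ≤ ⟪S x, x⟫_ℝ * ⟪S y, y⟫_ℝ := by
  have hsymm : ⟪S y, x⟫_ℝ = ⟪S x, y⟫_ℝ := by
    rw [hS.inner_left_eq_inner_right, real_inner_comm]
  have key : ∀ t : ℝ, 0 ≤ ⟪S x, x⟫_ℝ * (t * t) + 2 * ⟪S x, y⟫_ℝ * t + ⟪S y, y⟫_ℝ := by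
    intro t
    have h := hS.inner_nonneg_left (t • x + y)
    simp only [map_add, map_smul, inner_add_left, inner_add_right, inner_smul_left,
      inner_smul_right, hsymm, conj_trivial] at h
    linarith
  have := discrim_le_zero key
  unfold discrim at this
  linarith

variable [CompleteSpace H]

theorem ContinuousLinearMap.isUnit_of_coercive {T : H →L[ℝ] H} {c : ℝ} (hc : 0 < c)
    (h : ∀ x, c * ‖x‖ ^ 2 ≤ ⟪T x, x⟫_ℝ) : IsUnit T := by
  refine T.isUnit_of_forall_le_norm_inner_map (c := ⟨c, hc.le⟩) hc fun x => ?_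
  have := h x
  calc ‖x‖ ^ 2 * c ≤ ⟪T x, x⟫_ℝ := by linarith
    _ ≤ _ := le_abs_self _

omit [CompleteSpace H] in
-- Cauchy–Schwarz for the form of `S`, applied to `S⁻¹ x` and `x`, gives `‖x‖⁴ ≤ ⟪x, S⁻¹ x⟫ ⟪S x,
-- x⟫`.
theorem ContinuousLinearMap.IsPositive.exists_coercive {S : H →L[ℝ] H} (hS : S.IsPositive)
    (hu : IsUnit S) : ∃ c > 0, ∀ x, c * ‖x‖ ^ 2 ≤ ⟪S x, x⟫_ℝ := by
  obtain ⟨u, rfl⟩ := hu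
  set B : H →L[ℝ] H := ((u⁻¹ : (H →L[ℝ] H)ˣ) : H →L[ℝ] H) with hB
  refine ⟨(‖B‖ + 1)⁻¹, by positivity, fun x => ?_⟩
  have hSB : (u : H →L[ℝ] H) (B x) = x := by
    rw [← mul_apply_eq_comp, hB, Units.mul_inv]; rfl
  have h1 := hS.inner_sq_le (B x) x
  rw [hSB, real_inner_self_eq_norm_sq] at h1
  have h2 : ⟪x, B x⟫_ℝ ≤ (‖B‖ + 1) * ‖x‖ ^ 2 := by
    calc ⟪x, B x⟫_ℝ ≤ ‖x‖ * ‖B x‖ := real_inner_le_norm _ _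
      _ ≤ ‖x‖ * (‖B‖ * ‖x‖) := by gcongr; exact B.le_opNorm x
      _ ≤ (‖B‖ + 1) * ‖x‖ ^ 2 := by nlinarith [sq_nonneg ‖x‖]
  have h0 := hS.inner_nonneg_left x
  have h3 : (‖x‖ ^ 2) ^ 2 ≤ (‖B‖ + 1) * ‖x‖ ^ 2 * ⟪(u : H →L[ℝ] H) x, x⟫_ℝ :=
    h1.trans (by gcongr)
  rcases eq_or_lt_of_le (sq_nonneg ‖x‖) with hx | hx
  · rw [← hx]; simpa using h0
  · rw [inv_mul_le_iff₀ (by positivity)]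
    nlinarith

/-- A bounded self-adjoint operator that is not positive has a negative spectral value. -/
theorem IsSelfAdjoint.exists_neg_not_isUnit {B : H →L[ℝ] H} (hB : IsSelfAdjoint B)
    {x : H} (hx : ⟪B x, x⟫_ℝ < 0) : ∃ η > 0, ¬ IsUnit (B + algebraMap ℝ (H →L[ℝ] H) η) := by
  -- The infimum `μ` of the numerical range is the spectral value sought: `B - μ` is positive, and
  -- if it were invertible it would be coercive, which would raise the infimum.
  set s : Set ℝ := {r | ∃ y : H, ‖y‖ = 1 ∧ r = ⟪B y, y⟫_ℝ} with hs
  have hx0 : 0 < ‖x‖ := by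
    rw [norm_pos_iff]; rintro rfl; simp at hx
  have hxs : ⟪B x, x⟫_ℝ / ‖x‖ ^ 2 ∈ s := by
    refine ⟨‖x‖⁻¹ • x, by rw [norm_smul, norm_inv, norm_norm, inv_mul_cancel₀ hx0.ne'], ?_⟩
    simp only [map_smul, inner_smul_left, inner_smul_right, conj_trivial]
    field_simp
  have hbdd : BddBelow s := by
    refine ⟨-‖B‖, ?_⟩
    rintro r ⟨y, hy, rfl⟩
    have h1 : |⟪B y, y⟫_ℝ| ≤ ‖B‖ := by
      calc |⟪B y, y⟫_ℝ| ≤ ‖B y‖ * ‖y‖ := abs_real_inner_le_norm _ _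
        _ ≤ ‖B‖ * ‖y‖ * ‖y‖ := by gcongr; exact B.le_opNorm y
        _ = ‖B‖ := by rw [hy]; ring
    exact (abs_le.1 h1).1
  set μ := sInf s with hμ
  have hμ0 : μ < 0 := (csInf_le hbdd hxs).trans_lt (div_neg_of_neg_of_pos hx (by positivity))
  have hform : ∀ (η : ℝ) (y : H), ⟪(B + algebraMap ℝ (H →L[ℝ] H) η) y, y⟫_ℝ =
      ⟪B y, y⟫_ℝ + η * ‖y‖ ^ 2 := by
    intro η y
    rw [Algebra.algebraMap_eq_smul_one]
    simp [inner_add_left, inner_smul_left]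
  have hlow : ∀ y, μ * ‖y‖ ^ 2 ≤ ⟪B y, y⟫_ℝ := by
    intro y
    rcases eq_or_lt_of_le (norm_nonneg y) with hy | hy
    · rw [norm_eq_zero.1 hy.symm]; simp
    · have : ⟪B y, y⟫_ℝ / ‖y‖ ^ 2 ∈ s := by
        refine ⟨‖y‖⁻¹ • y, by rw [norm_smul, norm_inv, norm_norm, inv_mul_cancel₀ hy.ne'], ?_⟩
        simp only [map_smul, inner_smul_left, inner_smul_right, conj_trivial]
        field_simp
      exact (le_div_iff₀ (by positivity)).1 (csInf_le hbdd this)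
  refine ⟨-μ, by linarith, fun hu => ?_⟩
  have hpos : (B + algebraMap ℝ (H →L[ℝ] H) (-μ)).IsPositive := by
    refine ContinuousLinearMap.isPositive_def'.2 ⟨?_, fun y => ?_⟩
    · exact hB.add (IsSelfAdjoint.algebraMap _ (IsSelfAdjoint.all _))
    · rw [ContinuousLinearMap.reApplyInnerSelf_apply, RCLike.re_to_real, hform]
      linarith [hlow y]
  obtain ⟨c, hc, hcx⟩ := hpos.exists_coercive hu
  have : μ + c ≤ μ := by
    refine le_csInf ⟨_, hxs⟩ ?_
    rintro r ⟨y, hy, rfl⟩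
    have := hcx y
    rw [hform, hy] at this
    linarith
  linarith

theorem IsSelfAdjoint.aeval_polynomial {T : H →L[ℝ] H} (hT : IsSelfAdjoint T) (p : ℝ[X]) :
    IsSelfAdjoint (aeval T p) := by
  induction p using Polynomial.induction_on' with
  | add p q hp hq => rw [map_add]; exact hp.add hq
  | monomial n a =>
    rw [aeval_monomial, ← Algebra.smul_def]
    exact (IsSelfAdjoint.all a).smul (hT.pow n)

/-- Half of the spectral mapping theorem without complexification: a real linear factor is
invertible because its root is off the spectrum, and an irreducible quadratic with root `z` is `(T -
Re z)² + (Im z)²`, which is coercive. -/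
theorem IsSelfAdjoint.isUnit_aeval {T : H →L[ℝ] H} (hT : IsSelfAdjoint T) {p : ℝ[X]}
    (hp0 : p ≠ 0) (hp : ∀ a ∈ spectrum ℝ T, p.eval a ≠ 0) : IsUnit (aeval T p) := by
  induction p using WfDvdMonoid.induction_on_irreducible with
  | zero => exact absurd rfl hp0
  | unit u hu => exact hu.map (aeval T)
  | mul a i ha hi ih =>
    rw [map_mul]
    refine IsUnit.mul ?_ (ih ha fun x hx h => hp x hx (by rw [eval_mul, h, mul_zero]))
    have hp' : ∀ x ∈ spectrum ℝ T, i.eval x ≠ 0 := fun x hx h =>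
      hp x hx (by rw [eval_mul, h, zero_mul])
    obtain ⟨z, hz⟩ := IsAlgClosed.exists_aeval_eq_zero ℂ i (degree_pos_of_irreducible hi).ne'
    by_cases him : z.im = 0
    · have hzr : z = (z.re : ℂ) := Complex.ext rfl (by simp [him])
      have hroot : i.IsRoot z.re := by
        rw [hzr, show ((z.re : ℝ) : ℂ) = algebraMap ℝ ℂ z.re from rfl,
          aeval_algebraMap_apply] at hz
        simpa [aeval_def] using hz
      have hdvd := dvd_iff_isRoot.2 hroot
      have hass := (irreducible_X_sub_C z.re).associated_of_dvd hi hdvd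
      refine ((hass.map (aeval T : ℝ[X] →ₐ[ℝ] _)).isUnit_iff).1 ?_
      have hns : z.re ∉ spectrum ℝ T := fun h => hp' _ h hroot
      rw [spectrum.notMem_iff] at hns
      have := hns.neg
      simpa using this
    · have hdvd := quadratic_dvd_of_aeval_eq_zero_im_ne_zero i hz him
      set q : ℝ[X] := X ^ 2 - C (2 * z.re) * X + C (‖z‖ ^ 2) with hq
      have hqu : ¬ IsUnit q := by
        intro h
        have hd := natDegree_eq_zero_of_isUnit h
        have : q.natDegree = 2 := by rw [hq]; compute_degree!
        omega
      obtain ⟨r, hr⟩ := hdvd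
      have hass : Associated q i := by
        rcases hi.isUnit_or_isUnit hr with h | h
        · exact absurd h hqu
        · exact ⟨h.unit, hr.symm⟩
      refine ((hass.map (aeval T : ℝ[X] →ₐ[ℝ] _)).isUnit_iff).1 ?_
      have him2 : 0 < z.im ^ 2 := by positivity
      refine ContinuousLinearMap.isUnit_of_coercive him2 fun x => ?_
      have hnorm : ‖z‖ ^ 2 = z.re ^ 2 + z.im ^ 2 := by
        rw [Complex.sq_norm, Complex.normSq_apply]; ring
      have hTT : ⟪T (T x), x⟫_ℝ = ‖T x‖ ^ 2 := by
        rw [← real_inner_self_eq_norm_sq]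
        exact hT.isSymmetric (T x) x
      have hval : ⟪(aeval T q) x, x⟫_ℝ =
          ‖T x‖ ^ 2 - 2 * z.re * ⟪T x, x⟫_ℝ + (z.re ^ 2 + z.im ^ 2) * ‖x‖ ^ 2 := by
        rw [hq, hnorm]
        simp only [map_add, map_sub, map_mul, map_pow, aeval_X, aeval_C,
          Algebra.algebraMap_eq_smul_one]
        simp [inner_add_left, inner_sub_left, inner_smul_left, pow_two, hTT]
        ring
      have hsq : ‖T x - z.re • x‖ ^ 2 =
          ‖T x‖ ^ 2 - 2 * z.re * ⟪T x, x⟫_ℝ + z.re ^ 2 * ‖x‖ ^ 2 := by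
        rw [norm_sub_sq_real, inner_smul_right, norm_smul, mul_pow, Real.norm_eq_abs, sq_abs]
        ring
      rw [hval]
      nlinarith [sq_nonneg ‖T x - z.re • x‖]

theorem IsSelfAdjoint.spectrum_real_nonempty [Nontrivial H] {T : H →L[ℝ] H}
    (hT : IsSelfAdjoint T) : (spectrum ℝ T).Nonempty := by
  rw [Set.nonempty_iff_ne_empty]
  intro hne
  obtain ⟨x, hx⟩ := exists_ne (0 : H)
  -- With empty spectrum every nonzero polynomial of `T` would be invertible; but `-T² - 1` is
  -- negative, so some shift `-T² - 1 + ν` is not.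
  have hB : IsSelfAdjoint (-T ^ 2 - 1) := ((hT.pow 2).neg).sub (IsSelfAdjoint.one _)
  have hneg : ⟪(-T ^ 2 - 1 : H →L[ℝ] H) x, x⟫_ℝ < 0 := by
    have hTT : ⟪T (T x), x⟫_ℝ = ‖T x‖ ^ 2 := by
      rw [← real_inner_self_eq_norm_sq]; exact hT.isSymmetric (T x) x
    have : 0 < ‖x‖ ^ 2 := by positivity
    have h2 : ⟪(-T ^ 2 - 1 : H →L[ℝ] H) x, x⟫_ℝ = - ‖T x‖ ^ 2 - ‖x‖ ^ 2 := by
      simp [inner_sub_left, pow_two, hTT]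
    rw [h2]; nlinarith [sq_nonneg ‖T x‖]
  obtain ⟨ν, -, hnu⟩ := hB.exists_neg_not_isUnit hneg
  have hp : (-X ^ 2 - 1 + C ν : ℝ[X]) ≠ 0 := by
    intro h
    have h2 : (-X ^ 2 - 1 + C ν : ℝ[X]).natDegree = 2 := by compute_degree!
    rw [h, natDegree_zero] at h2
    omega
  exact hnu (by simpa using hT.isUnit_aeval hp (by simp [hne]))

/-- Positivity of polynomials of a bounded self-adjoint operator. -/
theorem IsSelfAdjoint.inner_aeval_nonneg {T : H →L[ℝ] H} (hT : IsSelfAdjoint T) {p : ℝ[X]}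
    (hp : ∀ a ∈ spectrum ℝ T, 0 ≤ p.eval a) (x : H) : 0 ≤ ⟪(aeval T p) x, x⟫_ℝ := by
  by_contra! hx
  have hx0 : x ≠ 0 := by rintro rfl; simp at hx
  have : Nontrivial H := ⟨x, 0, hx0⟩
  obtain ⟨η, hη, hu⟩ := (hT.aeval_polynomial p).exists_neg_not_isUnit hx
  have he : (aeval T p) + algebraMap ℝ (H →L[ℝ] H) η = aeval T (p + C η) := by simp
  have hpos : ∀ a ∈ spectrum ℝ T, (p + C η).eval a ≠ 0 := fun a ha => by
    have := hp a ha
    rw [eval_add, eval_C]; positivity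
  rw [he] at hu
  -- Since `p + η` is positive on the spectrum, `p(T) + η` is invertible. A point of the spectrum is
  -- needed only to see that this polynomial is nonzero.
  refine hu (hT.isUnit_aeval (fun h0 => ?_) hpos)
  obtain ⟨a, ha⟩ := hT.spectrum_real_nonempty
  exact hpos a ha (by rw [h0, eval_zero])

end BoundedOperators

/-! ### Cutting off finitely many eigenvalues of finite multiplicity. -/

section SpectralCutoff

open Polynomial
open scoped InnerProductSpace

variable {H : Type*} [NormedAddCommGroup H] [InnerProductSpace ℝ H]

theorem ContinuousLinearMap.finiteDimensional_ker_mul {A B : H →L[ℝ] H}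
    (hA : FiniteDimensional ℝ A.ker) (hB : FiniteDimensional ℝ B.ker) :
    FiniteDimensional ℝ (A * B).ker := by
  rw [← Submodule.fg_iff_finiteDimensional] at *
  refine Submodule.fg_of_fg_map_of_fg_inf_ker (B : H →ₗ[ℝ] H) ?_ ?_
  · have : FiniteDimensional ℝ A.ker := Submodule.fg_iff_finiteDimensional _ |>.1 hA
    refine (Submodule.fg_iff_finiteDimensional _).2 (Submodule.finiteDimensional_of_le
      (S₂ := A.ker) ?_)
    rintro _ ⟨x, hx, rfl⟩
    simpa using hx
  · have : FiniteDimensional ℝ B.ker := Submodule.fg_iff_finiteDimensional _ |>.1 hB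
    exact (Submodule.fg_iff_finiteDimensional _).2 (Submodule.finiteDimensional_of_le
      (S₂ := B.ker) inf_le_right)

theorem ContinuousLinearMap.finiteDimensional_ker_aeval_prod {T : H →L[ℝ] H} (S : Finset ℝ)
    (hS : ∀ s ∈ S, FiniteDimensional ℝ (T - algebraMap ℝ (H →L[ℝ] H) s).ker) :
    FiniteDimensional ℝ (aeval T (∏ s ∈ S, (X - C s))).ker := by
  classical
  induction S using Finset.induction_on with
  | empty =>
    rw [← Submodule.fg_iff_finiteDimensional]
    have : (aeval T (∏ s ∈ (∅ : Finset ℝ), (X - C s))).ker = ⊥ := by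
      ext x; simp
    rw [this]
    exact Submodule.fg_bot
  | insert a S ha ih =>
    rw [Finset.prod_insert ha, map_mul]
    refine ContinuousLinearMap.finiteDimensional_ker_mul ?_
      (ih fun s hs => hS s (Finset.mem_insert_of_mem hs))
    rw [map_sub, aeval_X, aeval_C]
    exact hS a (Finset.mem_insert_self _ _)

theorem Real.finite_of_isCompact_of_isolated {K : Set ℝ} (hK : IsCompact K)
    (h : ∀ s ∈ K, ∃ δ > 0, ∀ u ∈ K, |u - s| < δ → u = s) : K.Finite := by
  by_contra hinf
  obtain ⟨x, hx, hacc⟩ := Set.Infinite.exists_accPt_of_subset_isCompact hinf hK subset_rfl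
  obtain ⟨δ, hδ, hu⟩ := h x hx
  obtain ⟨y, ⟨hy, hyK⟩, hne⟩ := accPt_iff_nhds.1 hacc _ (Metric.ball_mem_nhds x hδ)
  exact hne (hu y hyK (by simpa [Real.dist_eq] using hy))

variable [CompleteSpace H]

/-- If the spectrum of a bounded self-adjoint operator `T ≤ 1` above the level `c` consists of
isolated points with finite-dimensional eigenspaces, then `T ≤ c` up to a projection of finite
rank. -/
theorem IsSelfAdjoint.exists_finiteDimensional_inner_le {T : H →L[ℝ] H} (hT : IsSelfAdjoint T)
    (hT1 : ∀ x, ⟪T x, x⟫_ℝ ≤ ‖x‖ ^ 2) {c : ℝ} (hc0 : 0 ≤ c)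
    (hfin : ∀ s ∈ spectrum ℝ T, c ≤ s →
      FiniteDimensional ℝ (T - algebraMap ℝ (H →L[ℝ] H) s).ker)
    (hiso : ∀ s ∈ spectrum ℝ T, c ≤ s → ∃ δ > 0, ∀ u ∈ spectrum ℝ T, |u - s| < δ → u = s) :
    ∃ (N : Submodule ℝ H) (_ : FiniteDimensional ℝ N), ∀ x,
      ⟪T x, x⟫_ℝ ≤ c * ‖x‖ ^ 2 + ‖N.starProjection x‖ ^ 2 := by
  have hK : (spectrum ℝ T ∩ Set.Ici c).Finite := by
    refine Real.finite_of_isCompact_of_isolated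
      ((spectrum.isCompact T).inter_right isClosed_Ici) ?_
    rintro s ⟨hs, hcs⟩
    obtain ⟨δ, hδ, h⟩ := hiso s hs hcs
    exact ⟨δ, hδ, fun u hu => h u hu.1⟩
  set S : Finset ℝ := hK.toFinset with hS
  have hmem : ∀ s, s ∈ S ↔ s ∈ spectrum ℝ T ∧ c ≤ s := fun s => by simp [hS]
  -- The kernel of `Q(T)` collects the eigenspaces above `c`, and its orthogonal complement is the
  -- closure of the range of `Q(T)`. On the range, `T ≤ c` amounts to `Q (c - X) Q ≥ 0` on the
  -- spectrum: `Q` vanishes at the spectral points `≥ c`, and `c - X` is positive at the others.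
  set Q : ℝ[X] := ∏ s ∈ S, (X - C s) with hQ
  have hN : FiniteDimensional ℝ (aeval T Q).ker :=
    ContinuousLinearMap.finiteDimensional_ker_aeval_prod S fun s hs =>
      hfin s ((hmem s).1 hs).1 ((hmem s).1 hs).2
  set N : Submodule ℝ H := (aeval T Q).ker with hNdef
  refine ⟨N, hN, ?_⟩
  have hQsa : IsSelfAdjoint (aeval T Q) := hT.aeval_polynomial Q
  have hcomm : ∀ x, (aeval T Q) (T x) = T ((aeval T Q) x) := by
    intro x
    have : (aeval T Q) * (aeval T (X : ℝ[X])) = (aeval T (X : ℝ[X])) * (aeval T Q) := by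
      rw [← map_mul, ← map_mul, mul_comm]
    rw [aeval_X] at this
    exact congrArg (fun A : H →L[ℝ] H => A x) this
  have hinv : ∀ x ∈ N, T x ∈ N := by
    intro x hx
    have hx' : (aeval T Q) x = 0 := hx
    change (aeval T Q) (T x) = 0
    rw [hcomm, hx', map_zero]
  have hrange : ∀ x, ⟪T ((aeval T Q) x), (aeval T Q) x⟫_ℝ ≤ c * ‖(aeval T Q) x‖ ^ 2 := by
    intro x
    have hp : ∀ a ∈ spectrum ℝ T, 0 ≤ (Q * (C c - X) * Q).eval a := by
      intro a ha
      by_cases hca : c ≤ a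
      · have : Q.eval a = 0 := by
          rw [hQ, eval_prod]
          exact Finset.prod_eq_zero ((hmem a).2 ⟨ha, hca⟩) (by simp)
        simp [this]
      · simp only [eval_mul, eval_sub, eval_C, eval_X]
        nlinarith [mul_nonneg (sq_nonneg (Q.eval a)) (sub_nonneg.2 (not_le.1 hca).le)]
    have h := hT.inner_aeval_nonneg hp x
    rw [map_mul, map_mul] at h
    have hsymm : ⟪(aeval T Q) (((aeval T) (C c - X)) ((aeval T Q) x)), x⟫_ℝ =
        ⟪((aeval T) (C c - X)) ((aeval T Q) x), (aeval T Q) x⟫_ℝ :=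
      hQsa.isSymmetric (((aeval T) (C c - X)) ((aeval T Q) x)) x
    simp only [mul_apply_eq_comp] at h
    have h2 : 0 ≤ ⟪((aeval T) (C c - X)) ((aeval T Q) x), (aeval T Q) x⟫_ℝ := by
      rw [← hsymm]
      exact h
    simp only [map_sub, aeval_C, aeval_X, Algebra.algebraMap_eq_smul_one] at h2
    simp only [sub_apply, smul_apply, one_apply_eq_self, inner_sub_left, inner_smul_left, conj_trivial,
      real_inner_self_eq_norm_sq] at h2
    linarith
  have horth : ∀ x ∈ Nᗮ, ⟪T x, x⟫_ℝ ≤ c * ‖x‖ ^ 2 := by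
    intro x hx
    rw [hNdef, ContinuousLinearMap.orthogonal_ker,
      ContinuousLinearMap.isSelfAdjoint_iff'.1 hQsa] at hx
    have hcl : IsClosed {x : H | ⟪T x, x⟫_ℝ ≤ c * ‖x‖ ^ 2} :=
      isClosed_le (by fun_prop) (by fun_prop)
    refine closure_minimal (s := (((aeval T Q).range : Submodule ℝ H) : Set H)) ?_ hcl hx
    rintro _ ⟨y, rfl⟩
    exact hrange y
  intro x
  set p := N.starProjection x with hp
  set y := x - p with hy
  have hpN : p ∈ N := Submodule.starProjection_apply_mem N x
  have hyN : y ∈ Nᗮ := Submodule.sub_starProjection_mem_orthogonal x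
  have hxe : x = p + y := by rw [hy]; abel
  have h1 : ⟪T p, y⟫_ℝ = 0 := hyN _ (hinv p hpN)
  have h2 : ⟪T y, p⟫_ℝ = 0 := by
    have := hT.isSymmetric y p
    rw [show ⟪T y, p⟫_ℝ = ⟪y, T p⟫_ℝ from this, real_inner_comm]
    exact h1
  have h3 : ⟪p, y⟫_ℝ = 0 := hyN _ hpN
  have h4 : ‖x‖ ^ 2 = ‖p‖ ^ 2 + ‖y‖ ^ 2 := by
    rw [hxe, norm_add_sq_real, h3]; ring
  have h5 : ⟪T x, x⟫_ℝ = ⟪T p, p⟫_ℝ + ⟪T y, y⟫_ℝ := by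
    conv_lhs => rw [hxe]
    rw [map_add, inner_add_left, inner_add_right, inner_add_right, h1, h2]; ring
  rw [h5, h4]
  have := horth y hyN
  have := hT1 p
  nlinarith [mul_nonneg hc0 (sq_nonneg ‖p‖)]

end SpectralCutoff

/-! ### The form domain as a closed subspace of a Hilbert space of pairs (function, gradient). -/

/-- The real Hilbert space of square summable functions on `ι`. -/
abbrev SqSum (ι : Type*) := lp (fun _ : ι => ℝ) 2

namespace SqSum

variable {ι : Type*}

theorem hasSum_sq (h : SqSum ι) : HasSum (fun i => h i ^ 2) (‖h‖ ^ 2) := by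
  have := lp.hasSum_norm (p := 2) (by norm_num) h
  simpa using this

theorem tsum_ofReal_sq (h : SqSum ι) :
    ∑' i, ENNReal.ofReal (h i ^ 2) = ENNReal.ofReal (‖h‖ ^ 2) := by
  rw [← (hasSum_sq h).tsum_eq,
    ENNReal.ofReal_tsum_of_nonneg (fun i => sq_nonneg _) (hasSum_sq h).summable]

theorem exists_coe_eq {f : ι → ℝ} (hf : ∑' i, ENNReal.ofReal (f i ^ 2) ≠ ∞) :
    ∃ h : SqSum ι, ⇑h = f := by
  have hs : Summable fun i => f i ^ 2 := by
    have := ENNReal.summable_toReal hf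
    simpa [ENNReal.toReal_ofReal, sq_nonneg] using this
  refine ⟨⟨f, memℓp_gen ?_⟩, rfl⟩
  simpa using hs

end SqSum

namespace WeightedGraph

variable {V : Type*} (G : WeightedGraph V)

theorem w_nonneg (x y : V) : 0 ≤ G.w x y := by
  by_cases h : G.graph.Adj x y
  · exact (G.w_pos x y h).le
  · rw [G.w_zero x y h]

theorem finite_support_w (x : V) : (Function.support (G.w x)).Finite :=
  (G.finite_neighborSet x).subset fun y hy => by
    by_contra h
    exact hy (G.w_zero x y h)

theorem sqrt_m_pos (x : V) : 0 < √(G.m x) := Real.sqrt_pos.2 (G.m_pos x)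

theorem sq_sqrt_m (x : V) : √(G.m x) ^ 2 = G.m x := Real.sq_sqrt (G.m_pos x).le

/-- The unitary identification of `ℓ²(V)` with `ℓ²(V, m)`. -/
noncomputable def ofL2 : SqSum V →ₗ[ℝ] (V → ℝ) where
  toFun h x := h x / √(G.m x)
  map_add' h k := by ext x; simp [add_div]
  map_smul' c h := by ext x; simp [mul_div_assoc]

theorem ofL2_apply (h : SqSum V) (x : V) : G.ofL2 h x = h x / √(G.m x) := rfl

theorem sqrt_m_mul_ofL2 (h : SqSum V) (x : V) : √(G.m x) * G.ofL2 h x = h x := by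
  rw [ofL2_apply, mul_div_cancel₀ _ (G.sqrt_m_pos x).ne']

theorem ofL2_injective : Function.Injective G.ofL2 := by
  intro h k hk
  ext x
  rw [← G.sqrt_m_mul_ofL2, hk, G.sqrt_m_mul_ofL2]

theorem normSq_eq (f : V → ℝ) :
    G.normSq f = ∑' x, ENNReal.ofReal ((√(G.m x) * f x) ^ 2) := by
  simp only [normSq, mul_pow, G.sq_sqrt_m]

theorem normSq_ofL2 (h : SqSum V) : G.normSq (G.ofL2 h) = ENNReal.ofReal (‖h‖ ^ 2) := by
  rw [normSq_eq, ← SqSum.tsum_ofReal_sq h]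
  simp only [G.sqrt_m_mul_ofL2]

theorem memL2_ofL2 (h : SqSum V) : G.MemL2 (G.ofL2 h) := by
  rw [MemL2, normSq_ofL2]; exact ENNReal.ofReal_lt_top

theorem MemL2.exists_ofL2_eq {G : WeightedGraph V} {f : V → ℝ} (hf : G.MemL2 f) :
    ∃ h, G.ofL2 h = f := by
  rw [MemL2, normSq_eq] at hf
  obtain ⟨h, hh⟩ := SqSum.exists_coe_eq hf.ne
  refine ⟨h, ?_⟩
  ext x
  rw [ofL2_apply, hh, mul_div_cancel_left₀ _ (G.sqrt_m_pos x).ne']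

/-- The weighted gradient, whose squared `ℓ²`-norm is the energy. -/
noncomputable def grad : (V → ℝ) →ₗ[ℝ] (V × V → ℝ) where
  toFun f p := √(G.w p.1 p.2 / 2) * (f p.1 - f p.2)
  map_add' f g := by ext p; simp; ring
  map_smul' c f := by ext p; simp; ring

theorem grad_apply (f : V → ℝ) (x y : V) :
    G.grad f (x, y) = √(G.w x y / 2) * (f x - f y) := rfl

theorem grad_mul (f g : V → ℝ) (x y : V) :
    G.grad f (x, y) * G.grad g (x, y) = G.w x y / 2 * (f x - f y) * (g x - g y) := by
  have : √(G.w x y / 2) ^ 2 = G.w x y / 2 := Real.sq_sqrt (by have := G.w_nonneg x y; positivity)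
  rw [grad_apply, grad_apply]
  linear_combination (f x - f y) * (g x - g y) * this

theorem energy_eq (f : V → ℝ) : G.energy f = ∑' p, ENNReal.ofReal (G.grad f p ^ 2) := by
  rw [energy, ENNReal.tsum_prod (f := fun x y => ENNReal.ofReal (G.grad f (x, y) ^ 2)),
    ENNReal.div_eq_inv_mul, ← ENNReal.tsum_mul_left]
  refine tsum_congr fun x => ?_
  rw [← ENNReal.tsum_mul_left]
  refine tsum_congr fun y => ?_
  rw [pow_two (G.grad f (x, y)), grad_mul,
    show G.w x y / 2 * (f x - f y) * (f x - f y) = 2⁻¹ * (G.w x y * (f x - f y) ^ 2) by ring,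
    ENNReal.ofReal_mul (by norm_num : (0 : ℝ) ≤ 2⁻¹), ENNReal.ofReal_inv_of_pos (by norm_num)]
  norm_num

theorem finite_support_grad {f : V → ℝ} (hf : (Function.support f).Finite) :
    (Function.support (G.grad f)).Finite := by
  have h1 : (⋃ x ∈ Function.support f, (Prod.mk x) '' (Function.support (G.w x))).Finite :=
    hf.biUnion fun x _ => (G.finite_support_w x).image _
  refine (h1.union (h1.image Prod.swap)).subset ?_
  rintro ⟨x, y⟩ hxy
  rw [Function.mem_support, grad_apply] at hxy
  have hw : G.w x y ≠ 0 := by rintro h; simp [h] at hxy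
  by_cases hx : f x = 0
  · have hy : f y ≠ 0 := by rintro h; simp [h, hx] at hxy
    right
    refine ⟨(y, x), ?_, rfl⟩
    simp only [Set.mem_iUnion]
    exact ⟨y, hy, x, by rwa [Function.mem_support, G.w_symm], rfl⟩
  · left
    simp only [Set.mem_iUnion]
    exact ⟨x, hx, y, hw, rfl⟩

theorem energy_lt_top {f : V → ℝ} (hf : (Function.support f).Finite) : G.energy f < ∞ := by
  rw [energy_eq, tsum_eq_sum (s := (G.finite_support_grad hf).toFinset)]
  · exact ENNReal.sum_lt_top.2 fun _ _ => ENNReal.ofReal_lt_top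
  · intro p hp
    have : G.grad f p = 0 := by simpa using hp
    simp [this]

theorem memL2_of_finite_support {f : V → ℝ} (hf : (Function.support f).Finite) : G.MemL2 f := by
  rw [MemL2, normSq, tsum_eq_sum (s := hf.toFinset)]
  · exact ENNReal.sum_lt_top.2 fun _ _ => ENNReal.ofReal_lt_top
  · intro p hp
    have : f p = 0 := by simpa using hp
    simp [this]

/-- The ambient Hilbert space of pairs of a function and a gradient field. -/
abbrev FormAmbient (V : Type*) := WithLp 2 (SqSum V × SqSum (V × V))

/-- The closed subspace of the pairs `(f, grad f)` with `f` of finite energy. -/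
def gradGraph : Submodule ℝ (FormAmbient V) where
  carrier := {u | ∀ p, u.snd p = G.grad (G.ofL2 u.fst) p}
  add_mem' {u v} hu hv p := by
    have hu := hu p
    have hv := hv p
    simp [hu, hv]
  zero_mem' p := by simp
  smul_mem' c u hu p := by
    have hu := hu p
    simp [hu]

theorem mem_gradGraph {u : FormAmbient V} :
    u ∈ G.gradGraph ↔ ∀ p, u.snd p = G.grad (G.ofL2 u.fst) p := Iff.rfl

theorem isClosed_gradGraph : IsClosed (G.gradGraph : Set (FormAmbient V)) := by
  have : (G.gradGraph : Set (FormAmbient V)) =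
      ⋂ p : V × V, {u | u.snd p = G.grad (G.ofL2 u.fst) p} := by
    ext u; simp [mem_gradGraph]
  rw [this]
  refine isClosed_iInter fun p => isClosed_eq ?_ ?_
  · exact (lp.evalCLM ℝ (fun _ : V × V => ℝ) 2 p).continuous.comp
      (WithLp.sndL 2 ℝ (SqSum V) (SqSum (V × V))).continuous
  · have h : ∀ x, Continuous fun u : FormAmbient V => u.fst x := fun x =>
      (lp.evalCLM ℝ (fun _ : V => ℝ) 2 x).continuous.comp
        (WithLp.fstL 2 ℝ (SqSum V) (SqSum (V × V))).continuous
    exact continuous_const.mul (((h p.1).div_const _).sub ((h p.2).div_const _))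

theorem gradGraph_ext {u v : FormAmbient V} (hu : u ∈ G.gradGraph) (hv : v ∈ G.gradGraph)
    (h : G.ofL2 u.fst = G.ofL2 v.fst) : u = v := by
  have h1 : u.fst = v.fst := G.ofL2_injective h
  have h2 : u.snd = v.snd := by
    ext p
    rw [hu p, hv p, h]
  exact (WithLp.ofLp_injective 2) (Prod.ext h1 h2)

theorem energy_of_mem_gradGraph {u : FormAmbient V} (hu : u ∈ G.gradGraph) :
    G.energy (G.ofL2 u.fst) = ENNReal.ofReal (‖u.snd‖ ^ 2) := by
  rw [energy_eq, ← SqSum.tsum_ofReal_sq]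
  exact tsum_congr fun p => by rw [hu p]

theorem exists_mem_gradGraph {f : V → ℝ} (h1 : G.normSq f < ∞) (h2 : G.energy f < ∞) :
    ∃ u ∈ G.gradGraph, G.ofL2 u.fst = f := by
  obtain ⟨h, hh⟩ := MemL2.exists_ofL2_eq h1
  rw [energy_eq] at h2
  obtain ⟨k, hk⟩ := SqSum.exists_coe_eq h2.ne
  exact ⟨WithLp.toLp 2 (h, k), fun p => by
    change k p = G.grad (G.ofL2 h) p
    rw [hh, hk], hh⟩

theorem exists_mem_gradGraph_of_finite_support {f : V → ℝ} (hf : (Function.support f).Finite) :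
    ∃ u ∈ G.gradGraph, G.ofL2 u.fst = f :=
  G.exists_mem_gradGraph (G.memL2_of_finite_support hf) (G.energy_lt_top hf)

open Classical in
theorem exists_indicator_mem_gradGraph (x : V) :
    ∃ u ∈ G.gradGraph, G.ofL2 u.fst = Pi.single x 1 :=
  G.exists_mem_gradGraph_of_finite_support
    ((Set.finite_singleton x).subset Pi.support_single_subset)

/-- The indicator function of a vertex together with its gradient. -/
noncomputable def indicatorPair (x : V) : FormAmbient V :=
  (G.exists_indicator_mem_gradGraph x).choose

theorem indicatorPair_mem (x : V) : G.indicatorPair x ∈ G.gradGraph :=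
  (G.exists_indicator_mem_gradGraph x).choose_spec.1

open Classical in
theorem ofL2_indicatorPair (x : V) : G.ofL2 (G.indicatorPair x).fst = Pi.single x 1 :=
  (G.exists_indicator_mem_gradGraph x).choose_spec.2

/-- The pairs `(φ, grad φ)` with `φ` finitely supported. -/
noncomputable def finiteForm : Submodule ℝ (FormAmbient V) := Submodule.span ℝ (Set.range G.indicatorPair)

/-- The form domain, as a Hilbert space. -/
noncomputable abbrev formSpace : Submodule ℝ (FormAmbient V) := G.finiteForm.topologicalClosure

theorem finiteForm_le_gradGraph : G.finiteForm ≤ G.gradGraph :=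
  Submodule.span_le.2 (by rintro _ ⟨x, rfl⟩; exact G.indicatorPair_mem x)

theorem formSpace_le_gradGraph : G.formSpace ≤ G.gradGraph :=
  Submodule.topologicalClosure_minimal _ G.finiteForm_le_gradGraph G.isClosed_gradGraph

theorem finite_support_of_mem_finiteForm {u : FormAmbient V} (hu : u ∈ G.finiteForm) :
    (Function.support (G.ofL2 u.fst)).Finite := by
  classical
  induction hu using Submodule.span_induction with
  | mem u hu =>
    obtain ⟨x, rfl⟩ := hu
    rw [ofL2_indicatorPair]
    exact (Set.finite_singleton x).subset Pi.support_single_subset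
  | zero => simp
  | add u v _ _ hu hv =>
    rw [WithLp.add_fst, map_add]
    exact (hu.union hv).subset (Function.support_add _ _)
  | smul c u _ hu =>
    rw [WithLp.smul_fst, map_smul]
    exact hu.subset (Function.support_const_smul_subset _ _)

/-- A finitely supported function is a combination of indicators, and an element of `gradGraph` is
determined by its function part. With `finite_support_of_mem_finiteForm`, this identifies
`finiteForm` with `C₀(V)`. -/
theorem mem_finiteForm_of_finite_support {u : FormAmbient V} (hu : u ∈ G.gradGraph)
    (hf : (Function.support (G.ofL2 u.fst)).Finite) : u ∈ G.finiteForm := by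
  classical
  set f := G.ofL2 u.fst with hfdef
  set v : FormAmbient V := ∑ x ∈ hf.toFinset, f x • G.indicatorPair x with hv
  have hvF : v ∈ G.finiteForm := Submodule.sum_mem _ fun x _ =>
    Submodule.smul_mem _ _ (Submodule.subset_span ⟨x, rfl⟩)
  have hvf : G.ofL2 v.fst = f := by
    have hl : ∀ u : FormAmbient V, G.ofL2 u.fst =
        (G.ofL2 ∘ₗ (WithLp.fstₗ 2 ℝ (SqSum V) (SqSum (V × V)))) u := fun u => rfl
    have hterm : ∀ x, (G.ofL2 ∘ₗ (WithLp.fstₗ 2 ℝ (SqSum V) (SqSum (V × V))))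
        (f x • G.indicatorPair x) = f x • Pi.single x 1 := fun x => by
      rw [map_smul, ← hl, ofL2_indicatorPair]
    rw [hl, hv, map_sum, Finset.sum_congr rfl fun x _ => hterm x]
    ext y
    rw [Finset.sum_apply]
    simp only [Pi.smul_apply, Pi.single_apply, smul_eq_mul, mul_ite, mul_one, mul_zero]
    rw [Finset.sum_ite_eq]
    split_ifs with h
    · rfl
    · simpa [eq_comm] using h
  rwa [G.gradGraph_ext hu (G.finiteForm_le_gradGraph hvF) (by rw [hvf])]

theorem memFormDomain_iff (f : V → ℝ) :
    G.MemFormDomain f ↔ ∃ u ∈ G.formSpace, G.ofL2 u.fst = f := by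
  constructor
  · rintro ⟨φ, hφ, h1, h2⟩
    choose v hv hvφ using fun n => G.exists_mem_gradGraph_of_finite_support (hφ n)
    have hvF : ∀ n, v n ∈ G.finiteForm := fun n =>
      G.mem_finiteForm_of_finite_support (hv n) (by rw [hvφ]; exact hφ n)
    -- The limit `f` is not known in advance to have finite norm and energy; it is a finitely
    -- supported function plus a remainder that has both.
    have hex : ∃ n, G.normSq (f - φ n) < ∞ ∧ G.energy (f - φ n) < ∞ :=
      ((h1.eventually_lt_const ENNReal.zero_lt_top).and
        (h2.eventually_lt_const ENNReal.zero_lt_top)).exists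
    obtain ⟨n₀, hn1, hn2⟩ := hex
    obtain ⟨r, hr, hrf⟩ := G.exists_mem_gradGraph hn1 hn2
    set u := r + v n₀ with hu
    have huG : u ∈ G.gradGraph := Submodule.add_mem _ hr (hv n₀)
    have huf : G.ofL2 u.fst = f := by
      rw [hu, WithLp.add_fst, map_add, hrf, hvφ]; abel
    refine ⟨u, ?_, huf⟩
    have hdiff : ∀ n, ENNReal.ofReal (‖u - v n‖ ^ 2) =
        G.normSq (f - φ n) + G.energy (f - φ n) := by
      intro n
      have hd : G.ofL2 (u - v n).fst = f - φ n := by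
        rw [WithLp.sub_fst, map_sub, huf, hvφ]
      rw [WithLp.prod_norm_sq_eq_of_L2, ENNReal.ofReal_add (by positivity) (by positivity),
        ← G.normSq_ofL2, ← G.energy_of_mem_gradGraph (Submodule.sub_mem _ huG (hv n)), hd]
    have hlim : Tendsto (fun n => ‖u - v n‖ ^ 2) atTop (𝓝 0) := by
      have h3 : Tendsto (fun n => ENNReal.ofReal (‖u - v n‖ ^ 2)) atTop (𝓝 0) := by
        simp only [hdiff]
        simpa using h1.add h2
      have h4 := (ENNReal.tendsto_toReal ENNReal.zero_ne_top).comp h3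
      simpa [Function.comp_def, ENNReal.toReal_ofReal, sq_nonneg] using h4
    have hlim2 : Tendsto v atTop (𝓝 u) := by
      rw [tendsto_iff_norm_sub_tendsto_zero]
      have := (Real.continuous_sqrt.tendsto 0).comp hlim
      simpa [Function.comp_def, Real.sqrt_sq, norm_sub_rev] using this
    exact mem_closure_of_tendsto hlim2 (Eventually.of_forall hvF)
  · rintro ⟨u, hu, rfl⟩
    obtain ⟨v, hv, hlim⟩ := mem_closure_iff_seq_limit.1 hu
    have huG := G.formSpace_le_gradGraph hu
    have hd : ∀ n, G.ofL2 u.fst - G.ofL2 (v n).fst = G.ofL2 (u - v n).fst := by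
      intro n; rw [WithLp.sub_fst, map_sub]
    have hz : Tendsto (fun n => ‖u - v n‖ ^ 2) atTop (𝓝 0) := by
      have := (tendsto_const_nhds (x := u)).sub hlim
      simpa using (this.norm.pow 2)
    have hz' := ENNReal.tendsto_ofReal hz
    rw [ENNReal.ofReal_zero] at hz'
    refine ⟨fun n => G.ofL2 (v n).fst, fun n => G.finite_support_of_mem_finiteForm (hv n), ?_, ?_⟩
    · refine tendsto_of_tendsto_of_tendsto_of_le_of_le tendsto_const_nhds hz'
        (fun _ => zero_le) fun n => ?_
      simp only [hd, normSq_ofL2]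
      refine ENNReal.ofReal_le_ofReal ?_
      rw [WithLp.prod_norm_sq_eq_of_L2]
      nlinarith [sq_nonneg ‖(u - v n).snd‖]
    · refine tendsto_of_tendsto_of_tendsto_of_le_of_le tendsto_const_nhds hz'
        (fun _ => zero_le) fun n => ?_
      have hm : u - v n ∈ G.gradGraph :=
        Submodule.sub_mem _ huG (G.finiteForm_le_gradGraph (hv n))
      simp only [hd, G.energy_of_mem_gradGraph hm]
      refine ENNReal.ofReal_le_ofReal ?_
      rw [WithLp.prod_norm_sq_eq_of_L2]
      nlinarith [sq_nonneg ‖(u - v n).fst‖]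

end WeightedGraph

/-! ### The resolvent and its correspondence with the spectrum of `-Δ`. -/

namespace WeightedGraph

open scoped InnerProductSpace

variable {V : Type*} (G : WeightedGraph V)

theorem m_mul_laplacian (f : V → ℝ) (x : V) :
    G.m x * G.laplacian f x = ∑' y, G.w x y * (f y - f x) := by
  rw [laplacian, ← tsum_mul_left]
  refine tsum_congr fun y => ?_
  have := (G.m_pos x).ne'
  field_simp

open Classical in
theorem tsum_grad_mul_grad_single (f : V → ℝ) (x : V) :
    ∑' p, G.grad f p * G.grad (Pi.single x 1) p = - (G.m x * G.laplacian f x) := by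
  -- By symmetry of `w`, the summand is `A(y, z) + A(z, y)`; both halves have the same sum, and only
  -- the star of `x` contributes to it.
  set A : V × V → ℝ := fun p => G.w p.1 p.2 / 2 * (f p.1 - f p.2) * (Pi.single x 1 : V → ℝ) p.1
    with hA
  have hsupp : Function.support A ⊆ (Prod.mk x) '' (Function.support (G.w x)) := by
    rintro ⟨y, z⟩ h
    have hy : y = x := by
      by_contra hne
      exact h (by simp [hA, Pi.single_eq_of_ne hne])
    subst hy
    refine ⟨z, fun hz => h (by simp [hA, hz]), rfl⟩
  have hsum : Summable A :=
    summable_of_hasFiniteSupport (((G.finite_support_w x).image _).subset hsupp)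
  have hsum' : Summable (fun p => A (Equiv.prodComm V V p)) :=
    (Equiv.summable_iff (Equiv.prodComm V V)).2 hsum
  have hAx : ∑' p, A p = ∑' y, G.w x y / 2 * (f x - f y) := by
    rw [← Function.Injective.tsum_eq (g := Prod.mk x) (Prod.mk_right_injective x)
      (hsupp.trans (Set.image_subset_range _ _))]
    simp [hA]
  have hsplit : ∀ p, G.grad f p * G.grad (Pi.single x 1) p =
      A p + A (Equiv.prodComm V V p) := by
    rintro ⟨y, z⟩
    rw [grad_mul]
    simp only [hA, Equiv.prodComm_apply, Prod.swap_prod_mk, G.w_symm z y]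
    ring
  simp only [hsplit]
  rw [hsum.tsum_add hsum', Equiv.tsum_eq (Equiv.prodComm V V) A, hAx, m_mul_laplacian,
    ← tsum_neg, ← two_mul, ← tsum_mul_left]
  exact tsum_congr fun y => by ring

theorem inner_indicatorPair {u : FormAmbient V} (hu : u ∈ G.gradGraph) (x : V) :
    ⟪u, G.indicatorPair x⟫_ℝ =
      G.m x * (G.ofL2 u.fst x - G.laplacian (G.ofL2 u.fst) x) := by
  classical
  have hfst : ∀ y, (G.indicatorPair x).fst y = √(G.m y) * (Pi.single x 1 : V → ℝ) y := fun y => by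
    rw [← G.ofL2_indicatorPair, sqrt_m_mul_ofL2]
  have h1 : ⟪u.fst, (G.indicatorPair x).fst⟫_ℝ = G.m x * G.ofL2 u.fst x := by
    rw [lp.inner_eq_tsum, tsum_eq_single x]
    · rw [hfst, Pi.single_eq_same, ← G.sqrt_m_mul_ofL2 u.fst x]
      simp only [RCLike.inner_apply, conj_trivial]
      linear_combination G.ofL2 u.fst x * G.sq_sqrt_m x
    · intro y hy
      rw [hfst, Pi.single_eq_of_ne hy]; simp
  have h2 : ⟪u.snd, (G.indicatorPair x).snd⟫_ℝ = - (G.m x * G.laplacian (G.ofL2 u.fst) x) := by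
    rw [lp.inner_eq_tsum, ← tsum_grad_mul_grad_single]
    refine tsum_congr fun p => ?_
    rw [hu p, G.indicatorPair_mem x p, ofL2_indicatorPair]
    simp [mul_comm]
  change ⟪u.fst, (G.indicatorPair x).fst⟫_ℝ + ⟪u.snd, (G.indicatorPair x).snd⟫_ℝ = _
  rw [h1, h2]; ring

/-- The embedding of the form domain into `ℓ²`. -/
noncomputable def formEmbed : G.formSpace →L[ℝ] SqSum V :=
  (WithLp.fstL 2 ℝ (SqSum V) (SqSum (V × V))).comp G.formSpace.subtypeL

theorem formEmbed_apply (u : G.formSpace) : G.formEmbed u = (u : FormAmbient V).fst := rfl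

/-- The resolvent `(-Δ + 1)⁻¹`, acting on `ℓ²(V) ≃ ℓ²(V, m)`. -/
noncomputable def resolvent : SqSum V →L[ℝ] SqSum V :=
  G.formEmbed ∘L ContinuousLinearMap.adjoint G.formEmbed

theorem resolvent_apply (g : SqSum V) :
    G.resolvent g = ((ContinuousLinearMap.adjoint G.formEmbed g : G.formSpace) :
      FormAmbient V).fst := rfl

theorem indicatorPair_mem_formSpace (x : V) : G.indicatorPair x ∈ G.formSpace :=
  Submodule.le_topologicalClosure _ (Submodule.subset_span ⟨x, rfl⟩)

theorem inner_fst_indicatorPair (g : SqSum V) (x : V) :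
    ⟪g, (G.indicatorPair x).fst⟫_ℝ = G.m x * G.ofL2 g x := by
  classical
  rw [lp.inner_eq_tsum, tsum_eq_single x]
  · rw [← G.sqrt_m_mul_ofL2 (G.indicatorPair x).fst x, ofL2_indicatorPair, Pi.single_eq_same,
      ← G.sqrt_m_mul_ofL2 g x]
    simp only [RCLike.inner_apply, conj_trivial]
    linear_combination G.ofL2 g x * G.sq_sqrt_m x
  · intro y hy
    rw [← G.sqrt_m_mul_ofL2 (G.indicatorPair x).fst y, ofL2_indicatorPair, Pi.single_eq_of_ne hy]
    simp

/-- Testing `⟪J* g, v⟫ = ⟪g, J v⟫` with `v` the indicator of a vertex turns the weak equation in the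
form domain into the pointwise one. -/
theorem ofL2_resolvent_sub_laplacian (g : SqSum V) :
    G.ofL2 (G.resolvent g) - G.laplacian (G.ofL2 (G.resolvent g)) = G.ofL2 g := by
  ext x
  set u : G.formSpace := ContinuousLinearMap.adjoint G.formEmbed g with hu
  have h1 := G.inner_indicatorPair (G.formSpace_le_gradGraph u.2) x
  have h2 : ⟪(u : FormAmbient V), G.indicatorPair x⟫_ℝ = G.m x * G.ofL2 g x := by
    have := ContinuousLinearMap.adjoint_inner_left G.formEmbed
      ⟨G.indicatorPair x, G.indicatorPair_mem_formSpace x⟩ g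
    rw [formEmbed_apply, inner_fst_indicatorPair] at this
    exact this
  rw [h2] at h1
  rw [resolvent_apply, ← hu, Pi.sub_apply]
  exact (mul_left_cancel₀ (G.m_pos x).ne' h1).symm

theorem memDomain_resolvent (g : SqSum V) : G.MemDomain (G.ofL2 (G.resolvent g)) := by
  refine ⟨(G.memFormDomain_iff _).2 ⟨_, Subtype.property _, rfl⟩, ?_⟩
  have : G.laplacian (G.ofL2 (G.resolvent g)) = G.ofL2 (G.resolvent g - g) := by
    rw [map_sub, ← G.ofL2_resolvent_sub_laplacian g]; abel
  rw [this]
  exact G.memL2_ofL2 _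

theorem MemDomain.eq_resolvent {G : WeightedGraph V} {f : V → ℝ} (hf : G.MemDomain f)
    {g : SqSum V} (h : f - G.laplacian f = G.ofL2 g) : f = G.ofL2 (G.resolvent g) := by
  obtain ⟨u, hu, rfl⟩ := (G.memFormDomain_iff f).1 hf.1
  set v : G.formSpace := ContinuousLinearMap.adjoint G.formEmbed g with hv
  -- Uniqueness: two solutions in the form domain differ by a vector orthogonal to all indicators,
  -- whose span is dense there.
  have horth : ∀ x, ⟪u - v, G.indicatorPair x⟫_ℝ = 0 := by
    intro x
    have h1 := G.inner_indicatorPair (G.formSpace_le_gradGraph hu) x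
    have h2 := G.inner_indicatorPair (G.formSpace_le_gradGraph v.2) x
    have h3 := congrFun h x
    have h4 := congrFun (G.ofL2_resolvent_sub_laplacian g) x
    rw [resolvent_apply, ← hv] at h4
    rw [Pi.sub_apply] at h3 h4
    rw [inner_sub_left, h1, h2, h3, h4, sub_self]
  have hmem : u - v ∈ G.formSpaceᗮ := by
    rw [show G.formSpaceᗮ = G.finiteFormᗮ from Submodule.orthogonal_closure _,
      Submodule.mem_orthogonal']
    intro w hw
    induction hw using Submodule.span_induction with
    | mem w hw => obtain ⟨x, rfl⟩ := hw; exact horth x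
    | zero => simp
    | add a b _ _ ha hb => rw [inner_add_right, ha, hb, add_zero]
    | smul c a _ ha => rw [inner_smul_right, ha, mul_zero]
  have hzero : u - v = 0 := by
    rw [← inner_self_eq_zero (𝕜 := ℝ)]
    exact hmem _ (Submodule.sub_mem _ hu v.2)
  rw [sub_eq_zero.1 hzero, resolvent_apply]

theorem isSelfAdjoint_resolvent : IsSelfAdjoint G.resolvent :=
  (ContinuousLinearMap.isPositive_self_comp_adjoint G.formEmbed).isSelfAdjoint

theorem inner_resolvent (g h : SqSum V) :
    ⟪G.resolvent g, h⟫_ℝ = ⟪ContinuousLinearMap.adjoint G.formEmbed g,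
      ContinuousLinearMap.adjoint G.formEmbed h⟫_ℝ := by
  rw [ContinuousLinearMap.adjoint_inner_right]; rfl

/-- A spectral gap of the form gives a bound on the resolvent. -/
theorem inner_resolvent_le {c : ℝ} (hc : 0 ≤ c)
    (h : ∀ u ∈ G.finiteForm, ‖u.fst‖ ^ 2 ≤ c * ‖u‖ ^ 2) (g : SqSum V) :
    ⟪G.resolvent g, g⟫_ℝ ≤ c * ‖g‖ ^ 2 := by
  have hcl : ∀ u ∈ G.formSpace, ‖u.fst‖ ^ 2 ≤ c * ‖u‖ ^ 2 := by
    intro u hu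
    have hclosed : IsClosed {u : FormAmbient V | ‖u.fst‖ ^ 2 ≤ c * ‖u‖ ^ 2} :=
      isClosed_le (((WithLp.fstL 2 ℝ (SqSum V) (SqSum (V × V))).continuous.norm).pow 2)
        (continuous_const.mul (continuous_norm.pow 2))
    exact closure_minimal h hclosed hu
  set v : G.formSpace := ContinuousLinearMap.adjoint G.formEmbed g with hv
  have h1 : ⟪G.resolvent g, g⟫_ℝ = ‖v‖ ^ 2 := by
    rw [inner_resolvent, ← hv, real_inner_self_eq_norm_sq]
  have h2 : ‖v‖ ^ 2 ≤ ‖G.formEmbed v‖ * ‖g‖ := by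
    rw [← h1]; exact real_inner_le_norm _ _
  have h3 : ‖G.formEmbed v‖ ^ 2 ≤ c * ‖v‖ ^ 2 := hcl v v.2
  rw [h1]
  have h4 : (‖v‖ ^ 2) ^ 2 ≤ c * ‖v‖ ^ 2 * ‖g‖ ^ 2 := by
    calc (‖v‖ ^ 2) ^ 2 ≤ (‖G.formEmbed v‖ * ‖g‖) ^ 2 := by gcongr
      _ = ‖G.formEmbed v‖ ^ 2 * ‖g‖ ^ 2 := by ring
      _ ≤ _ := by gcongr
  rcases eq_or_lt_of_le (sq_nonneg ‖v‖) with hz | hz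
  · rw [← hz]; positivity
  · nlinarith

theorem inner_resolvent_le_norm_sq (g : SqSum V) : ⟪G.resolvent g, g⟫_ℝ ≤ ‖g‖ ^ 2 := by
  have := G.inner_resolvent_le zero_le_one (fun u _ => by
    rw [WithLp.prod_norm_sq_eq_of_L2]; nlinarith [sq_nonneg ‖u.snd‖]) g
  simpa using this

theorem inner_resolvent_nonneg (g : SqSum V) : 0 ≤ ⟪G.resolvent g, g⟫_ℝ := by
  rw [inner_resolvent]; exact real_inner_self_nonneg

/-- With `R = (1 - Δ)⁻¹` one has `s - R = s (-Δ - (s⁻¹ - 1)) R`. Positive spectral values of `R`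
thus give spectral values of `-Δ`. -/
theorem isUnit_of_mem_resolventSet {s : ℝ} (hs : 0 < s) (h : s⁻¹ - 1 ∈ G.resolventSet) :
    IsUnit (algebraMap ℝ (SqSum V →L[ℝ] SqSum V) s - G.resolvent) := by
  have hval : ∀ g, (algebraMap ℝ (SqSum V →L[ℝ] SqSum V) s - G.resolvent) g =
      s • g - G.resolvent g := fun g => by
    rw [Algebra.algebraMap_eq_smul_one]; rfl
  rw [ContinuousLinearMap.isUnit_iff_bijective]
  constructor
  · rw [injective_iff_map_eq_zero]
    intro g hg
    rw [hval, sub_eq_zero] at hg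
    have h0 := (h.1 0 (by simp [MemL2, normSq])).unique (y₁ := G.ofL2 (G.resolvent g)) (y₂ := 0)
      ⟨G.memDomain_resolvent g, ?_⟩ ⟨?_, ?_⟩
    · have hz : G.resolvent g = 0 := G.ofL2_injective (by rw [h0, map_zero])
      rw [hz] at hg
      exact (smul_eq_zero.1 hg).resolve_left hs.ne'
    · have h1 := G.ofL2_resolvent_sub_laplacian g
      have h2 : G.ofL2 g = s⁻¹ • G.ofL2 (G.resolvent g) := by
        rw [← hg, map_smul, smul_smul, inv_mul_cancel₀ hs.ne', one_smul]
      rw [h2] at h1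
      rw [sub_smul, ← h1, one_smul]; abel
    · have := G.memDomain_resolvent 0
      rwa [map_zero, map_zero] at this
    · ext x; simp [laplacian]
  · intro k
    obtain ⟨f, ⟨hf, hfe⟩, -⟩ := h.1 (G.ofL2 (s⁻¹ • k)) (G.memL2_ofL2 _)
    obtain ⟨u, hu, huf⟩ := (G.memFormDomain_iff f).1 hf.1
    obtain ⟨l, hl⟩ := hf.2.exists_ofL2_eq
    have hg : f - G.laplacian f = G.ofL2 (u.fst - l) := by rw [map_sub, huf, hl]
    refine ⟨u.fst - l, ?_⟩
    have hres : G.resolvent (u.fst - l) = u.fst :=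
      G.ofL2_injective (by rw [← hf.eq_resolvent hg, huf])
    rw [hval, hres]
    apply G.ofL2_injective
    rw [map_sub, map_smul, ← hg, huf]
    have : G.ofL2 k = s • (-G.laplacian f - (s⁻¹ - 1) • f) := by
      rw [hfe, map_smul, smul_smul, mul_inv_cancel₀ hs.ne', one_smul]
    rw [this]
    ext x
    simp only [Pi.sub_apply, Pi.smul_apply, Pi.neg_apply, smul_eq_mul]
    field_simp
    ring

/-- The equation `-Δ f - t f = g` is equivalent to `(1 - (1 + t) R) f = R g`, with `R` the
resolvent, so the solution operator is the bounded operator `B R`. -/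
theorem mem_resolventSet_of_isUnit {t : ℝ}
    (h : IsUnit (1 - (1 + t) • G.resolvent : SqSum V →L[ℝ] SqSum V)) : t ∈ G.resolventSet := by
  obtain ⟨A, hA⟩ := h
  set B : SqSum V →L[ℝ] SqSum V := ((A⁻¹ : (SqSum V →L[ℝ] SqSum V)ˣ) : SqSum V →L[ℝ] SqSum V)
    with hB
  have hAB : ∀ k, B k - (1 + t) • G.resolvent (B k) = k := by
    intro k
    have : ((A : SqSum V →L[ℝ] SqSum V) * B) k = k := by rw [hB, Units.mul_inv]; rfl
    rw [hA] at this
    exact this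
  have hBA : ∀ k, B (k - (1 + t) • G.resolvent k) = k := by
    intro k
    have : (B * (A : SqSum V →L[ℝ] SqSum V)) k = k := by rw [hB, Units.inv_mul]; rfl
    rw [hA] at this
    exact this
  have key : ∀ (f : V → ℝ) (g : SqSum V), G.MemDomain f → -G.laplacian f - t • f = G.ofL2 g →
      f = G.ofL2 (B (G.resolvent g)) := by
    intro f g hf hfg
    obtain ⟨u, hu, huf⟩ := (G.memFormDomain_iff f).1 hf.1
    have h1 : f - G.laplacian f = G.ofL2 (g + (1 + t) • u.fst) := by
      rw [map_add, map_smul, huf, ← hfg, add_smul, one_smul]; abel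
    have h2 : u.fst = G.resolvent (g + (1 + t) • u.fst) :=
      G.ofL2_injective (by rw [← hf.eq_resolvent h1, huf])
    rw [map_add, map_smul, ← sub_eq_iff_eq_add] at h2
    rw [← h2, hBA, huf]
  refine ⟨fun g hg => ?_, ?_⟩
  · obtain ⟨g, rfl⟩ := hg.exists_ofL2_eq
    set f := B (G.resolvent g) with hf
    have h1 : f = G.resolvent (g + (1 + t) • f) := by
      rw [map_add, map_smul, ← sub_eq_iff_eq_add]; exact hAB _
    refine ⟨G.ofL2 f, ⟨by rw [h1]; exact G.memDomain_resolvent _, ?_⟩, fun f' hf' =>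
      key f' g hf'.1 hf'.2⟩
    have h2 := G.ofL2_resolvent_sub_laplacian (g + (1 + t) • f)
    rw [← h1, map_add, map_smul, add_smul, one_smul] at h2
    have h3 : G.laplacian (G.ofL2 f) = - (G.ofL2 g + t • G.ofL2 f) := by
      rw [← sub_eq_zero] at h2 ⊢
      rw [← neg_eq_zero, ← h2]; abel
    rw [h3]; abel
  · refine ⟨(‖B ∘L G.resolvent‖₊) ^ 2, fun f hf => ?_⟩
    obtain ⟨l, hl⟩ := hf.2.exists_ofL2_eq
    obtain ⟨u, hu, huf⟩ := (G.memFormDomain_iff f).1 hf.1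
    have hg : -G.laplacian f - t • f = G.ofL2 (-l - t • u.fst) := by
      rw [map_sub, map_neg, map_smul, hl, huf]
    have hfe := key f _ hf hg
    rw [hg, hfe, normSq_ofL2, normSq_ofL2, ENNReal.coe_pow, ← ENNReal.ofReal_coe_nnreal,
      ← ENNReal.ofReal_pow (by positivity), ← ENNReal.ofReal_mul (by positivity), ← mul_pow]
    refine ENNReal.ofReal_le_ofReal ?_
    gcongr
    exact (B ∘L G.resolvent).le_opNorm _

/-- A lower bound of the form on finitely supported functions is a lower bound of the spectrum. -/
theorem mem_resolventSet_of_energy_ge {b t : ℝ} (hb : 0 ≤ b) (ht : t < b)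
    (h : ∀ f : V → ℝ, (Function.support f).Finite →
      ENNReal.ofReal b * G.normSq f ≤ G.energy f) : t ∈ G.resolventSet := by
  have hle : ∀ g, ⟪G.resolvent g, g⟫_ℝ ≤ (1 + b)⁻¹ * ‖g‖ ^ 2 := by
    refine G.inner_resolvent_le (by positivity) fun u hu => ?_
    have h1 := h _ (G.finite_support_of_mem_finiteForm hu)
    rw [normSq_ofL2, G.energy_of_mem_gradGraph (G.finiteForm_le_gradGraph hu),
      ← ENNReal.ofReal_mul hb, ENNReal.ofReal_le_ofReal_iff (by positivity)] at h1
    rw [WithLp.prod_norm_sq_eq_of_L2, le_inv_mul_iff₀ (by positivity)]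
    linarith
  apply mem_resolventSet_of_isUnit
  have hval : ∀ x, ⟪(1 - (1 + t) • G.resolvent : SqSum V →L[ℝ] SqSum V) x, x⟫_ℝ =
      ‖x‖ ^ 2 - (1 + t) * ⟪G.resolvent x, x⟫_ℝ := fun x => by
    simp only [sub_apply, smul_apply, one_apply_eq_self, inner_sub_left, inner_smul_left,
      conj_trivial, real_inner_self_eq_norm_sq]
  -- The upper bound on the resolvent helps only for `1 + t > 0`; otherwise its positivity suffices.
  by_cases ht1 : 1 + t ≤ 0
  · refine ContinuousLinearMap.isUnit_of_coercive one_pos fun x => ?_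
    rw [hval]
    nlinarith [mul_nonneg (neg_nonneg.2 ht1) (G.inner_resolvent_nonneg x)]
  · have hb1 : 0 < 1 + b := by positivity
    refine ContinuousLinearMap.isUnit_of_coercive (c := 1 - (1 + t) * (1 + b)⁻¹) ?_ fun x => ?_
    · rw [sub_pos, ← div_eq_mul_inv, div_lt_one hb1]; linarith
    · rw [hval]
      have := mul_le_mul_of_nonneg_left (hle x) (not_le.1 ht1).le
      nlinarith

end WeightedGraph

/-! ### From the spectral cutoff to a lower bound of the form outside a finite set. -/

open scoped InnerProductSpace in
-- The finitely many vectors of an orthonormal basis of `N` are close in norm to their truncations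
-- to one finite set `K`, so their inner products with `x` hardly see `x` off `K`.
theorem SqSum.exists_finset_norm_starProjection_le {ι : Type*} (N : Submodule ℝ (SqSum ι))
    [FiniteDimensional ℝ N] {ε : ℝ} (hε : 0 < ε) :
    ∃ (K : Finset ι) (C : ℝ), 0 ≤ C ∧ ∀ x : SqSum ι,
      ‖N.starProjection x‖ ^ 2 ≤ ε * ‖x‖ ^ 2 + C * ∑ k ∈ K, x k ^ 2 := by
  classical
  set b := stdOrthonormalBasis ℝ N with hb
  set n := Module.finrank ℝ N with hn
  -- Chosen so that the `n` errors `2 η² ‖x‖²` add up to at most `ε ‖x‖²`; the `+ 1` covers `n = 0`.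
  set η : ℝ := √(ε / (2 * (n + 1))) with hη
  have hη0 : 0 < η := Real.sqrt_pos.2 (by positivity)
  have hη2 : η ^ 2 = ε / (2 * (n + 1)) := Real.sq_sqrt (by positivity)
  have hev : ∀ᶠ K : Finset ι in atTop, ∀ i,
      ‖(b i : SqSum ι) - ∑ k ∈ K, lp.single 2 k ((b i : SqSum ι) k)‖ < η := by
    rw [eventually_all]
    intro i
    have hs := lp.hasSum_single (p := 2) (by norm_num) (b i : SqSum ι)
    have := (tendsto_const_nhds (x := (b i : SqSum ι))).sub hs
    rw [sub_self] at this
    have hn := this.norm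
    rw [norm_zero] at hn
    exact hn.eventually_lt_const hη0
  obtain ⟨K, hK⟩ := hev.exists
  refine ⟨K, 2 * n, by positivity, fun x => ?_⟩
  have hi : ∀ i, ⟪(b i : SqSum ι), x⟫_ℝ ^ 2 ≤ 2 * ∑ k ∈ K, x k ^ 2 + 2 * (η ^ 2 * ‖x‖ ^ 2) := by
    intro i
    set v : SqSum ι := (b i : SqSum ι) with hv
    set r : SqSum ι := ∑ k ∈ K, lp.single 2 k (v k) with hr
    have hvn : ‖v‖ = 1 := b.orthonormal.1 i
    have h1 : ⟪v, x⟫_ℝ = ⟪r, x⟫_ℝ + ⟪v - r, x⟫_ℝ := by rw [inner_sub_left]; ring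
    have h2 : ⟪r, x⟫_ℝ = ∑ k ∈ K, v k * x k := by
      rw [hr, sum_inner]
      refine Finset.sum_congr rfl fun k _ => ?_
      rw [lp.inner_single_left]
      simp [mul_comm]
    have h3 : ⟪r, x⟫_ℝ ^ 2 ≤ ∑ k ∈ K, x k ^ 2 := by
      rw [h2]
      refine (Finset.sum_mul_sq_le_sq_mul_sq _ _ _).trans ?_
      have hle : ∑ k ∈ K, v k ^ 2 ≤ 1 := by
        have := sum_le_hasSum K (fun k _ => sq_nonneg (v k)) (SqSum.hasSum_sq v)
        rwa [hvn, one_pow] at this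
      have := mul_le_mul_of_nonneg_right hle
        (Finset.sum_nonneg fun k (_ : k ∈ K) => sq_nonneg (x k))
      linarith
    have h4 : ⟪v - r, x⟫_ℝ ^ 2 ≤ η ^ 2 * ‖x‖ ^ 2 := by
      rw [← mul_pow, ← sq_abs]
      have := (abs_real_inner_le_norm (v - r) x).trans
        (mul_le_mul_of_nonneg_right (hK i).le (norm_nonneg x))
      gcongr
    rw [h1]
    nlinarith [sq_nonneg (⟪r, x⟫_ℝ - ⟪v - r, x⟫_ℝ)]
  have hP : ‖N.starProjection x‖ ^ 2 = ∑ i, ⟪(b i : SqSum ι), x⟫_ℝ ^ 2 := by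
    have h1 : ‖N.starProjection x‖ = ‖N.orthogonalProjectionOnto x‖ := rfl
    rw [h1, ← b.sum_sq_norm_inner_right]
    refine Finset.sum_congr rfl fun i _ => ?_
    rw [Real.norm_eq_abs, sq_abs, Submodule.inner_orthogonalProjectionOnto_eq_of_mem_left]
  rw [hP]
  refine (Finset.sum_le_sum fun i _ => hi i).trans ?_
  rw [Finset.sum_const, Finset.card_univ, Fintype.card_fin, nsmul_eq_mul, hη2]
  have h5 : (n : ℝ) * (2 * (ε / (2 * (n + 1)) * ‖x‖ ^ 2)) ≤ ε * ‖x‖ ^ 2 := by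
    have : (n : ℝ) * (2 * (ε / (2 * (n + 1)) * ‖x‖ ^ 2)) =
        (n / (n + 1)) * (ε * ‖x‖ ^ 2) := by field_simp
    rw [this]
    refine mul_le_of_le_one_left (by positivity) ?_
    rw [div_le_one (by positivity)]; linarith
  linarith

namespace WeightedGraph

open scoped InnerProductSpace

variable {V : Type*} (G : WeightedGraph V)

theorem mem_laplacianSpectrum_of_mem_spectrum {s : ℝ} (hs : 0 < s)
    (h : s ∈ spectrum ℝ G.resolvent) : s⁻¹ - 1 ∈ G.laplacianSpectrum := fun hr =>
  h (G.isUnit_of_mem_resolventSet hs hr)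

theorem mem_eigenspace_of_mem_ker {s : ℝ} (hs : 0 < s) {g : SqSum V}
    (hg : g ∈ (G.resolvent - algebraMap ℝ (SqSum V →L[ℝ] SqSum V) s).ker) :
    G.ofL2 g ∈ G.eigenspace (s⁻¹ - 1) := by
  have h0 : G.resolvent g = s • g := by
    have : G.resolvent g - s • g = 0 := by
      have h := LinearMap.mem_ker.1 hg
      rw [Algebra.algebraMap_eq_smul_one] at h
      exact h
    exact sub_eq_zero.1 this
  have h1 : G.resolvent (s⁻¹ • g) = g := by
    rw [map_smul, h0, smul_smul, inv_mul_cancel₀ hs.ne', one_smul]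
  refine Submodule.subset_span ⟨?_, ?_⟩
  · have := G.memDomain_resolvent (s⁻¹ • g)
    rwa [h1] at this
  · have := G.ofL2_resolvent_sub_laplacian (s⁻¹ • g)
    rw [h1, map_smul] at this
    rw [sub_smul, ← this, one_smul]; abel

theorem mem_discreteSpectrum_of_lt_muE {t : ℝ} (ht : (t : EReal) < G.muE)
    (hs : t ∈ G.laplacianSpectrum) : t ∈ G.discreteSpectrum := by
  by_contra h
  exact absurd ht (not_lt.2 (sInf_le ⟨t, ⟨hs, h⟩, rfl⟩))

/-- Below the essential spectrum, the form is bounded below up to a finite set of vertices. -/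
theorem exists_form_bound {t : ℝ} (ht0 : 0 < t) (ht : (t : EReal) < G.muE) :
    ∃ t' > t, ∃ (K : Finset V) (C : ℝ), 0 ≤ C ∧ ∀ f : V → ℝ, (Function.support f).Finite →
      ∀ e : ℝ, 0 ≤ e → G.energy f ≤ ENNReal.ofReal e → ∀ S : Finset V,
        t' * ∑ x ∈ S, G.m x * f x ^ 2 ≤ e + C * ∑ x ∈ K, G.m x * f x ^ 2 := by
  obtain ⟨t₁, ht1, ht1'⟩ := EReal.lt_iff_exists_real_btwn.1 ht
  rw [EReal.coe_lt_coe_iff] at ht1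
  have ht10 : 0 < t₁ := ht0.trans ht1
  have hc0 : 0 < (1 + t₁)⁻¹ := by positivity
  set c := (1 + t₁)⁻¹ with hc
  have hdisc : ∀ s ∈ spectrum ℝ G.resolvent, c ≤ s → s⁻¹ - 1 ∈ G.discreteSpectrum := by
    intro s hs hcs
    have hs0 : 0 < s := hc0.trans_le hcs
    refine G.mem_discreteSpectrum_of_lt_muE ?_ (G.mem_laplacianSpectrum_of_mem_spectrum hs0 hs)
    refine lt_of_le_of_lt ?_ ht1'
    rw [EReal.coe_le_coe_iff]
    have : s⁻¹ ≤ 1 + t₁ := by rw [inv_le_comm₀ hs0 (by positivity)]; exact hcs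
    linarith
  obtain ⟨N, hN, hle⟩ := G.isSelfAdjoint_resolvent.exists_finiteDimensional_inner_le
    G.inner_resolvent_le_norm_sq hc0.le
    (fun s hs hcs => by
      have hs0 : 0 < s := hc0.trans_le hcs
      have hfd := (hdisc s hs hcs).2.2.2
      refine FiniteDimensional.of_injective (V₂ := G.eigenspace (s⁻¹ - 1))
        ((G.ofL2.domRestrict _).codRestrict _
          fun g => G.mem_eigenspace_of_mem_ker hs0 g.2) ?_
      intro a b hab
      exact Subtype.ext (G.ofL2_injective (congrArg Subtype.val hab)))
    (fun s hs hcs => by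
      have hs0 : 0 < s := hc0.trans_le hcs
      obtain ⟨δ, hδ, hiso⟩ := (hdisc s hs hcs).2.1
      obtain ⟨δ', hδ', hcont⟩ := Metric.continuousAt_iff.1 (continuousAt_inv₀ hs0.ne') δ hδ
      -- Isolation is pulled back along `s ↦ s⁻¹ - 1`; a radius at most `s` keeps `u` positive.
      refine ⟨min δ' s, lt_min hδ' hs0, fun u hu hus => ?_⟩
      have hu0 : 0 < u := by
        have := (abs_lt.1 (hus.trans_le (min_le_right _ _))).1
        linarith
      have h1 := hcont (x := u) (by rw [Real.dist_eq]; exact hus.trans_le (min_le_left _ _))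
      have h2 := hiso _ (G.mem_laplacianSpectrum_of_mem_spectrum hu0 hu)
        (by rw [sub_sub_sub_cancel_right, ← Real.dist_eq]; exact h1)
      exact inv_injective (sub_left_injective h2))
  -- The room between `c = 1 / (1 + t₁)` and `c₂ = 1 / (1 + t')` is `2ε`: one `ε` for the projection
  -- off `K`, the other to absorb the term on `K`.
  set t' := (t + t₁) / 2 with ht'
  have htt' : t < t' := by rw [ht']; linarith
  have ht'0 : 0 < t' := ht0.trans htt'
  have hc2 : c < (1 + t')⁻¹ := by
    rw [hc]
    exact inv_strictAnti₀ (by positivity) (by rw [ht']; linarith)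
  set c₂ := (1 + t')⁻¹ with hc2def
  set ε := (c₂ - c) / 2 with hεdef
  have hε : 0 < ε := by rw [hεdef]; linarith
  obtain ⟨K, C, hC, hPK⟩ := SqSum.exists_finset_norm_starProjection_le N hε
  refine ⟨t', htt', K, (1 + t') * (C / ε), by positivity, fun f hf e he hfe S => ?_⟩
  obtain ⟨u, hu, rfl⟩ := G.exists_mem_gradGraph_of_finite_support hf
  have huF := G.mem_finiteForm_of_finite_support hu hf
  have hmf : ∀ x, G.m x * G.ofL2 u.fst x ^ 2 = u.fst x ^ 2 := fun x => by
    rw [← G.sqrt_m_mul_ofL2 u.fst x, mul_pow, G.sq_sqrt_m]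
  simp only [hmf]
  rw [G.energy_of_mem_gradGraph hu, ENNReal.ofReal_le_ofReal_iff he] at hfe
  set A := ‖u.fst‖ ^ 2 with hA
  have hSA : ∑ x ∈ S, u.fst x ^ 2 ≤ A :=
    sum_le_hasSum S (fun k _ => sq_nonneg _) (SqSum.hasSum_sq u.fst)
  set k := ∑ x ∈ K, u.fst x ^ 2 with hk
  have hk0 : 0 ≤ k := Finset.sum_nonneg fun _ _ => sq_nonneg _
  have hA0 : 0 ≤ A := sq_nonneg _
  set E₁ := ‖u‖ ^ 2 with hE1
  have hE : E₁ ≤ A + e := by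
    rw [hE1, WithLp.prod_norm_sq_eq_of_L2]; linarith
  have hE0 : 0 ≤ E₁ := sq_nonneg _
  -- Cauchy–Schwarz in `A = ⟪J* J u, u⟫` turns an upper bound on the resolvent `J J*` into a lower
  -- bound on the form.
  have hCS : A ^ 2 ≤ ((c + ε) * A + C * k) * E₁ := by
    set U : G.formSpace := ⟨u, Submodule.le_topologicalClosure _ huF⟩ with hU
    have h1 : A = ⟪ContinuousLinearMap.adjoint G.formEmbed u.fst, U⟫_ℝ := by
      rw [ContinuousLinearMap.adjoint_inner_left, hA, ← real_inner_self_eq_norm_sq]; rfl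
    have h2 : A ≤ ‖ContinuousLinearMap.adjoint G.formEmbed u.fst‖ * ‖u‖ := by
      rw [h1]; exact real_inner_le_norm _ _
    have h3 : ‖ContinuousLinearMap.adjoint G.formEmbed u.fst‖ ^ 2 =
        ⟪G.resolvent u.fst, u.fst⟫_ℝ := by
      rw [G.inner_resolvent, real_inner_self_eq_norm_sq]
    calc A ^ 2 ≤ (‖ContinuousLinearMap.adjoint G.formEmbed u.fst‖ * ‖u‖) ^ 2 := by gcongr
      _ = ⟪G.resolvent u.fst, u.fst⟫_ℝ * E₁ := by rw [mul_pow, h3]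
      _ ≤ _ := by
        gcongr
        have := hle u.fst
        have := hPK u.fst
        linarith
  have hmain : A ≤ c₂ * E₁ + C / ε * k := by
    by_contra! hlt
    have hcA : c₂ * E₁ < A := lt_of_le_of_lt (le_add_of_nonneg_right (by positivity)) hlt
    have hApos : 0 < A := lt_of_le_of_lt (by positivity) hcA
    have hc2' : c₂ = c + ε + ε := by rw [hεdef]; ring
    have hCk : C * k < ε * A := by
      have h1 : C / ε * k < A := lt_of_le_of_lt (le_add_of_nonneg_left (by positivity)) hlt
      have h2 : C * k = ε * (C / ε * k) := by field_simp
      rw [h2]; exact mul_lt_mul_of_pos_left h1 hε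
    have h2 : ((c + ε) * A + C * k) * E₁ ≤ c₂ * A * E₁ := by
      gcongr
      rw [hc2']; linarith
    nlinarith
  have h1t : 0 < 1 + t' := by positivity
  have hcc : (1 + t') * c₂ = 1 := mul_inv_cancel₀ h1t.ne'
  have hm2 := mul_le_mul_of_nonneg_left hmain h1t.le
  have hst := mul_le_mul_of_nonneg_left hSA (ht0.trans htt').le
  have : (1 + t') * (c₂ * E₁ + C / ε * k) = E₁ + (1 + t') * (C / ε) * k := by
    linear_combination E₁ * hcc
  linarith

end WeightedGraph

/-! ### Intrinsic metrics and the energy of exponential functions. -/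

namespace WeightedGraph

variable {V : Type*} {G : WeightedGraph V} {ρ : V → V → ℝ}

namespace IsAdmissible

theorem tsum_ofReal_le (hρ : G.IsAdmissible ρ) (x : V) :
    ∑' y, ENNReal.ofReal (G.w x y * ρ x y ^ 2) ≤ ENNReal.ofReal (G.m x) := by
  rw [← ENNReal.ofReal_tsum_of_nonneg]
  · exact ENNReal.ofReal_le_ofReal (hρ.intrinsic x)
  · exact fun y => mul_nonneg (G.w_nonneg x y) (sq_nonneg _)
  · refine summable_of_hasFiniteSupport ((G.finite_support_w x).subset fun y hy hw => hy ?_)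
    simp [hw]

/-- Each of `v x` and `v y` collects `∑ w ρ² ≤ m` over its neighbours; the factor `½` of the energy
cancels the two equal halves. -/
theorem energy_le (hρ : G.IsAdmissible ρ) {F v : V → ℝ} (hv : ∀ x, 0 ≤ v x)
    (h : ∀ x y, G.graph.Adj x y → (F x - F y) ^ 2 ≤ ρ x y ^ 2 * (v x + v y)) :
    G.energy F ≤ ∑' x, ENNReal.ofReal (G.m x * v x) := by
  have h1 : ∀ x y, ENNReal.ofReal (G.w x y * (F x - F y) ^ 2) ≤
      ENNReal.ofReal (G.w x y * ρ x y ^ 2) * ENNReal.ofReal (v x) +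
      ENNReal.ofReal (G.w y x * ρ y x ^ 2) * ENNReal.ofReal (v y) := by
    intro x y
    rw [G.w_symm y x, hρ.symm y x, ← mul_add, ← ENNReal.ofReal_add (hv x) (hv y),
      ← ENNReal.ofReal_mul (mul_nonneg (G.w_nonneg x y) (sq_nonneg _))]
    refine ENNReal.ofReal_le_ofReal ?_
    by_cases hxy : G.graph.Adj x y
    · rw [mul_assoc]
      exact mul_le_mul_of_nonneg_left (h x y hxy) (G.w_nonneg x y)
    · simp [G.w_zero x y hxy]
  have h2 : ∑' x, ∑' y, ENNReal.ofReal (G.w x y * ρ x y ^ 2) * ENNReal.ofReal (v x) ≤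
      ∑' x, ENNReal.ofReal (G.m x * v x) := by
    refine ENNReal.tsum_le_tsum fun x => ?_
    rw [ENNReal.tsum_mul_right, ENNReal.ofReal_mul (G.m_pos x).le]
    gcongr
    exact hρ.tsum_ofReal_le x
  have h3 : ∑' x, ∑' y, ENNReal.ofReal (G.w x y * (F x - F y) ^ 2) ≤
      2 * ∑' x, ENNReal.ofReal (G.m x * v x) := by
    calc ∑' x, ∑' y, ENNReal.ofReal (G.w x y * (F x - F y) ^ 2)
        ≤ ∑' x, ∑' y, (ENNReal.ofReal (G.w x y * ρ x y ^ 2) * ENNReal.ofReal (v x) +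
          ENNReal.ofReal (G.w y x * ρ y x ^ 2) * ENNReal.ofReal (v y)) :=
          ENNReal.tsum_le_tsum fun x => ENNReal.tsum_le_tsum fun y => h1 x y
      _ = ∑' x, ∑' y, ENNReal.ofReal (G.w x y * ρ x y ^ 2) * ENNReal.ofReal (v x) +
          ∑' x, ∑' y, ENNReal.ofReal (G.w y x * ρ y x ^ 2) * ENNReal.ofReal (v y) := by
          simp only [ENNReal.tsum_add]
      _ = ∑' x, ∑' y, ENNReal.ofReal (G.w x y * ρ x y ^ 2) * ENNReal.ofReal (v x) +
          ∑' x, ∑' y, ENNReal.ofReal (G.w x y * ρ x y ^ 2) * ENNReal.ofReal (v x) := by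
          congr 1
          rw [ENNReal.tsum_comm]
      _ ≤ 2 * ∑' x, ENNReal.ofReal (G.m x * v x) := by
          rw [two_mul]; exact add_le_add h2 h2
  rw [energy]
  exact ENNReal.div_le_of_le_mul' h3

theorem le_jumpSize (hρ : G.IsAdmissible ρ) {x y : V} (h : G.graph.Adj x y) :
    ρ x y ≤ G.jumpSize ρ := le_csSup hρ.finite_jump ⟨x, y, h, rfl⟩

theorem abs_sub_le (hρ : G.IsAdmissible ρ) (x y z : V) : |ρ x z - ρ y z| ≤ ρ x y := by
  rw [abs_le]
  have h1 := hρ.triangle x y z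
  have h2 := hρ.triangle y x z
  rw [hρ.symm y x] at h2
  constructor <;> linarith

/-- If no edge had positive length, connectedness would put the infinite set `V` into one finite
ball. -/
theorem jumpSize_pos [Infinite V] (hρ : G.IsAdmissible ρ) (x₀ : V) : 0 < G.jumpSize ρ := by
  by_contra! hs
  have hz : ∀ x y, ∀ p : G.graph.Walk x y, ρ x y ≤ 0 := by
    intro x y p
    induction p with
    | nil => exact (hρ.self _).le
    | cons h p ih =>
      exact (hρ.triangle _ _ _).trans (add_nonpos ((hρ.le_jumpSize h).trans hs) ih)
  have huniv : ball ρ x₀ 1 = Set.univ := by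
    ext y
    obtain ⟨p⟩ := G.connected.preconnected y x₀
    simp only [ball, Set.mem_ofPred_eq, Set.mem_univ, iff_true]
    exact (hz y x₀ p).trans zero_le_one
  exact Set.infinite_univ (huniv ▸ hρ.finite_ball x₀ 1 one_pos)

end IsAdmissible

theorem combDist_of_adj {x y : V} (h : G.graph.Adj x y) : G.combDist x y = 1 := by
  rw [combDist, SimpleGraph.dist_eq_one_iff_adj.2 h, Nat.cast_one]

theorem rate_pos (hs : 0 < G.jumpSize ρ) {t : ℝ} (ht : t ∈ G.rateDomain ρ 0) :
    0 < G.rate ρ 0 t := (G.rate_bijOn ρ hs).mapsTo ht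

theorem exp_rate_of_ne {t : ℝ} (hs : 0 < G.jumpSize ρ) (hne : ρ ≠ G.combDist) :
    Real.exp (G.rate ρ 0 t * G.jumpSize ρ) = 1 + G.jumpSize ρ * √(2 * t) := by
  rw [rate, if_neg hne, sub_zero]
  set s := G.jumpSize ρ
  rw [show 1 / s * Real.log (1 + s * √(2 * t)) * s = Real.log (1 + s * √(2 * t)) by field_simp]
  exact Real.exp_log (by positivity)

theorem exp_rate_combDist {t : ℝ} (ht0 : 0 < t) (ht1 : t < 1) :
    (1 - t) * (1 + Real.exp (G.rate G.combDist 0 t) ^ 2) =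
      2 * Real.exp (G.rate G.combDist 0 t) := by
  have h1 : 0 < 1 - t := by linarith
  rw [rate, if_pos rfl, sub_zero, div_one]
  have hr : √(1 - (1 - t) ^ 2) ^ 2 = 1 - (1 - t) ^ 2 := Real.sq_sqrt (by nlinarith)
  have hr0 := Real.sqrt_nonneg (1 - (1 - t) ^ 2)
  rw [Real.exp_add, Real.exp_log (by positivity), Real.exp_log (by positivity)]
  set r := √(1 - (1 - t) ^ 2)
  field_simp
  linear_combination hr

/-- This inequality dictates the formula for `a_0`. Dividing by the smaller exponential leaves `(E -
1)² ≤ ρ² t (1 + E²)` for `1 ≤ E ≤ e^{aρ}`. If `ρ = d`, then `ρ = 1` on edges and the claim reads `(1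
- t)(1 + E²) ≤ 2E`, true up to the larger root `E = e^a`. Otherwise convexity of `exp` on `[0, as]`
gives `E - 1 ≤ ρ √(2t)`, and `2 ≤ 1 + E²`. -/
theorem IsAdmissible.exp_sub_exp_sq_le [Infinite V] (hρ : G.IsAdmissible ρ) {t : ℝ}
    (ht : t ∈ G.rateDomain ρ 0) {φ : V → ℝ} {x y : V} (hxy : G.graph.Adj x y)
    (hφ : |φ x - φ y| ≤ G.rate ρ 0 t * ρ x y) :
    (Real.exp (φ x) - Real.exp (φ y)) ^ 2 ≤
      ρ x y ^ 2 * (t * Real.exp (φ x) ^ 2 + t * Real.exp (φ y) ^ 2) := by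
  have hs := hρ.jumpSize_pos x
  have ht0 : 0 < t := ht.1
  have ha := rate_pos hs ht
  set a := G.rate ρ 0 t with hadef
  have key : ∀ E : ℝ, 1 ≤ E → E ≤ Real.exp (a * ρ x y) →
      (E - 1) ^ 2 ≤ ρ x y ^ 2 * (t * (1 + E ^ 2)) := by
    intro E hE1 hE
    by_cases hne : ρ = G.combDist
    · have ht1 := ht.2 hne
      have h1 : ρ x y = 1 := by rw [hne, combDist_of_adj hxy]
      rw [h1, mul_one] at hE
      have h2 := exp_rate_combDist (G := G) ht0 ht1
      rw [← hne, ← hadef] at h2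
      set E₀ := Real.exp a
      rw [h1]
      have h3 : (1 - t) * (E₀ - E) * (E * E₀ - 1) =
          E * ((1 - t) * (1 + E₀ ^ 2)) - E₀ * ((1 - t) * (1 + E ^ 2)) := by ring
      have hE0 : 1 ≤ E₀ := hE1.trans hE
      have h4 : 0 ≤ (1 - t) * (E₀ - E) * (E * E₀ - 1) :=
        mul_nonneg (mul_nonneg (by linarith) (by linarith)) (by nlinarith)
      rw [h3, h2] at h4
      have h5 : (1 - t) * (1 + E ^ 2) ≤ 2 * E := by
        have : E₀ * ((1 - t) * (1 + E ^ 2)) ≤ E₀ * (2 * E) := by linarith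
        exact le_of_mul_le_mul_left this (by linarith)
      nlinarith
    · have hr0 := hρ.nonneg x y
      have hrs := hρ.le_jumpSize hxy
      have hexp := exp_rate_of_ne (t := t) hs hne
      rw [← hadef] at hexp
      set s := G.jumpSize ρ
      have hconv := convexOn_exp.2 (Set.mem_univ (a * s)) (Set.mem_univ 0)
        (show 0 ≤ ρ x y / s by positivity)
        (show 0 ≤ 1 - ρ x y / s by rw [sub_nonneg, div_le_one hs]; exact hrs) (by ring)
      simp only [smul_eq_mul, mul_zero, add_zero, Real.exp_zero, mul_one, hexp] at hconv
      rw [show ρ x y / s * (a * s) = a * ρ x y by field_simp] at hconv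
      have h1 : ρ x y / s * (1 + s * √(2 * t)) + (1 - ρ x y / s) = 1 + ρ x y * √(2 * t) := by
        field_simp
        ring
      rw [h1] at hconv
      have h2 : E - 1 ≤ ρ x y * √(2 * t) := by linarith
      have h3 : √(2 * t) ^ 2 = 2 * t := Real.sq_sqrt (by positivity)
      calc (E - 1) ^ 2 ≤ (ρ x y * √(2 * t)) ^ 2 := by gcongr
        _ = ρ x y ^ 2 * (2 * t) := by rw [mul_pow, h3]
        _ ≤ _ := by
          refine mul_le_mul_of_nonneg_left ?_ (sq_nonneg _)
          have : 1 ≤ E ^ 2 := one_le_pow₀ hE1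
          nlinarith
  have hfin : ∀ p q : ℝ, p ≤ q → q - p ≤ a * ρ x y →
      (Real.exp q - Real.exp p) ^ 2 ≤ ρ x y ^ 2 * (t * Real.exp p ^ 2 + t * Real.exp q ^ 2) := by
    intro p q hpq hqp
    have h1 := key (Real.exp (q - p)) (Real.one_le_exp (by linarith)) (Real.exp_le_exp.2 hqp)
    have h2 : Real.exp q = Real.exp (q - p) * Real.exp p := by
      rw [← Real.exp_add, sub_add_cancel]
    have h3 := mul_le_mul_of_nonneg_right h1 (sq_nonneg (Real.exp p))
    rw [h2]
    linarith
  rw [abs_le] at hφ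
  rcases le_total (φ x) (φ y) with h | h
  · rw [← neg_sub, neg_sq]
    exact hfin _ _ h (by linarith)
  · rw [add_comm (t * Real.exp (φ x) ^ 2)]
    exact hfin _ _ h (by linarith)

theorem mem_rateDomain [Infinite V] (hρ : G.IsAdmissible ρ) {t : ℝ} (ht0 : 0 < t)
    (ht : (t : EReal) < G.muE) : t ∈ G.rateDomain ρ 0 := by
  classical
  refine ⟨ht0, fun hd => ?_⟩
  obtain ⟨t', htt', K, C, -, hform⟩ := G.exists_form_bound ht0 ht
  obtain ⟨x, hx⟩ := Infinite.exists_notMem_finset K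
  -- For `ρ = d`, the indicator of a vertex off `K` has Rayleigh quotient at most 1, which forces `t
  -- < t' ≤ 1`.
  have hE : G.energy (Pi.single x 1) ≤ ENNReal.ofReal (G.m x) := by
    refine (hρ.energy_le (v := Pi.single x 1) (fun y => ?_) fun y z hyz => ?_).trans ?_
    · by_cases h : y = x
      · subst h; simp
      · simp [Pi.single_eq_of_ne h]
    · rw [hd, combDist_of_adj hyz]
      by_cases hy : y = x
      · subst hy; simp [Pi.single_eq_of_ne hyz.ne']
      · by_cases hz : z = x
        · subst hz; simp [Pi.single_eq_of_ne hyz.ne]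
        · simp [Pi.single_eq_of_ne hy, Pi.single_eq_of_ne hz]
    · rw [tsum_eq_single x fun y hy => by simp [Pi.single_eq_of_ne hy]]
      simp
  have h := hform (Pi.single x 1) ((Set.finite_singleton x).subset Pi.support_single_subset)
    (G.m x) (G.m_pos x).le hE {x}
  have hK : ∑ y ∈ K, G.m y * (Pi.single x (1 : ℝ) : V → ℝ) y ^ 2 = 0 :=
    Finset.sum_eq_zero fun y hy => by
      rw [Pi.single_eq_of_ne (by rintro rfl; exact hx hy)]; simp
  rw [hK] at h
  simp only [Finset.sum_singleton, Pi.single_eq_same] at h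
  have := G.m_pos x
  nlinarith

theorem vol_coe_finset (S : Finset V) : G.vol (S : Set V) = ENNReal.ofReal (∑ x ∈ S, G.m x) := by
  rw [vol, ENNReal.ofReal_sum_of_nonneg fun x _ => (G.m_pos x).le]
  exact Finset.tsum_subtype' S fun x => ENNReal.ofReal (G.m x)

theorem vol_univ : G.vol Set.univ = ∑' x, ENNReal.ofReal (G.m x) :=
  tsum_univ fun x => ENNReal.ofReal (G.m x)

end WeightedGraph

/-! ### Infinite volume: exponential growth of balls. -/

namespace WeightedGraph

variable {V : Type*} {G : WeightedGraph V} {ρ : V → V → ℝ}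

theorem mem_ball {x₀ y : V} {R : ℝ} : y ∈ ball ρ x₀ R ↔ ρ y x₀ ≤ R := Iff.rfl

theorem exists_finset_sum_gt (h : G.vol Set.univ = ∞) (M : ℝ) :
    ∃ S : Finset V, M < ∑ x ∈ S, G.m x := by
  by_contra! hle
  have : G.vol Set.univ ≤ ENNReal.ofReal M := by
    rw [vol_univ]
    refine ENNReal.summable.tsum_le_of_sum_le fun S => ?_
    rw [← ENNReal.ofReal_sum_of_nonneg fun x _ => (G.m_pos x).le]
    exact ENNReal.ofReal_le_ofReal (hle S)
  rw [h, top_le_iff] at this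
  exact ENNReal.ofReal_ne_top this

theorem exists_forall_mem_finset_le (ρ : V → V → ℝ) (x₀ : V) (S : Finset V) :
    ∃ r, 0 ≤ r ∧ ∀ x ∈ S, ρ x x₀ ≤ r := by
  obtain ⟨r, hr⟩ := (S.image fun x => ρ x x₀).exists_le
  exact ⟨max r 0, le_max_right _ _, fun x hx =>
    (hr _ (Finset.mem_image_of_mem _ hx)).trans (le_max_left _ _)⟩

theorem IsAdmissible.eventually_le_vol_ball [Infinite V] (hρ : G.IsAdmissible ρ) (x₀ : V)
    (hvol : G.vol Set.univ = ∞) {t : ℝ} (ht0 : 0 < t) (ht : (t : EReal) < G.muE) :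
    ∃ C : ℝ, 0 < C ∧ ∀ᶠ R : ℝ in atTop,
      ENNReal.ofReal (C * Real.exp (2 * G.rate ρ 0 t * R)) ≤ G.vol (ball ρ x₀ R) := by
  have hdom := mem_rateDomain hρ ht0 ht
  have hs := hρ.jumpSize_pos x₀
  have ha := rate_pos hs hdom
  obtain ⟨t', htt', K, C, hC, hform⟩ := G.exists_form_bound ht0 ht
  set a := G.rate ρ 0 t with hadef
  set s := G.jumpSize ρ with hsdef
  -- Makes `t (1 + δ)` the midpoint of `t` and `t'`, leaving a surplus `b` in the form bound.
  set δ := (t' - t) / (2 * t) with hδdef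
  have hδ : 0 < δ := div_pos (by linarith) (by linarith)
  have htδ : t * (1 + δ) = (t + t') / 2 := by rw [hδdef]; field_simp; ring
  set b := (t' - t) / 2 with hbdef
  have hb : 0 < b := by rw [hbdef]; linarith
  set CK := C * ∑ x ∈ K, G.m x with hCK
  -- Enough mass that the surplus `b Φ` exceeds the term on `K` by 1; the 4 pays for `F ≥ 1/2` on
  -- `S₀`.
  obtain ⟨S₀, hS₀⟩ := exists_finset_sum_gt hvol (4 * (CK + 1) / b)
  obtain ⟨r, hr0, hr⟩ := exists_forall_mem_finset_le ρ x₀ S₀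
  set C₂ := t * (1 + 1 / δ) with hC2
  have hC2pos : 0 < C₂ := by positivity
  refine ⟨C₂⁻¹ * Real.exp (-(2 * a * (r + s))), by positivity, ?_⟩
  have hsmall : ∀ᶠ R : ℝ in atTop, Real.exp (-(a * (R - s - r))) < 1 / 2 := by
    have h1 : Tendsto (fun R : ℝ => a * (R - s - r)) atTop atTop :=
      Tendsto.const_mul_atTop ha (tendsto_atTop_add_const_right _ _
        (tendsto_atTop_add_const_right _ _ tendsto_id))
    exact (Real.tendsto_exp_neg_atTop_nhds_zero.comp h1).eventually_lt_const (by norm_num)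
  filter_upwards [hsmall, eventually_gt_atTop (r + s)] with R₁ hε2 hR1
  -- `F` vanishes outside radius `R`, and an edge that meets the ball of radius `R` stays within `R
  -- + s = R₁`. So the energy is controlled by `u` on the ball of radius `R₁`.
  set R := R₁ - s with hRdef
  have hRr : r < R := by rw [hRdef]; linarith
  set ε := Real.exp (-(a * (R - r))) with hεdef
  have hε0 : 0 < ε := Real.exp_pos _
  set u : V → ℝ := fun y => Real.exp (-(a * max (ρ y x₀ - r) 0)) with hu
  have hu0 : ∀ y, 0 < u y := fun y => Real.exp_pos _
  have hu1 : ∀ y, u y ≤ 1 := fun y =>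
    Real.exp_le_one_iff.2 (neg_nonpos.2 (mul_nonneg ha.le (le_max_right _ _)))
  set F : V → ℝ := fun y => max (u y - ε) 0 with hF
  have hF0 : ∀ y, 0 ≤ F y := fun y => le_max_right _ _
  have hF1 : ∀ y, F y ≤ 1 := fun y => max_le (by linarith [hu1 y]) zero_le_one
  have hFz : ∀ y, R ≤ ρ y x₀ → F y = 0 := by
    intro y hy
    refine max_eq_right (sub_nonpos.2 (Real.exp_le_exp.2 (neg_le_neg ?_)))
    exact mul_le_mul_of_nonneg_left ((sub_le_sub_right hy r).trans (le_max_left _ _)) ha.le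
  have hfinS : (ball ρ x₀ R₁).Finite := hρ.finite_ball x₀ R₁ (by linarith)
  set S := hfinS.toFinset with hS
  have hmemS : ∀ y, y ∈ S ↔ ρ y x₀ ≤ R₁ := fun y => by rw [hS, Set.Finite.mem_toFinset, mem_ball]
  have hsupp : (Function.support F).Finite := hfinS.subset fun y hy => by
    by_contra hn
    rw [mem_ball, not_le] at hn
    exact hy (hFz y (by rw [hRdef]; linarith))
  classical
  set v : V → ℝ := fun y => if y ∈ S then t * u y ^ 2 else 0 with hv
  have hv0 : ∀ y, 0 ≤ v y := fun y => by
    rw [hv]; dsimp only; split_ifs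
    · positivity
    · exact le_rfl
  have hdiff : ∀ x y, G.graph.Adj x y → (F x - F y) ^ 2 ≤ ρ x y ^ 2 * (v x + v y) := by
    intro x y hxy
    have hρxy := hρ.abs_sub_le x y x₀
    have hjump := hρ.le_jumpSize hxy
    rw [abs_le] at hρxy
    by_cases hxR : R ≤ ρ x x₀ ∧ R ≤ ρ y x₀
    · rw [hFz x hxR.1, hFz y hxR.2, sub_zero, zero_pow two_ne_zero]
      exact mul_nonneg (sq_nonneg _) (add_nonneg (hv0 x) (hv0 y))
    · have hx : x ∈ S := by
        rw [hmemS]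
        by_contra! h
        exact hxR ⟨by linarith, by linarith⟩
      have hy : y ∈ S := by
        rw [hmemS]
        by_contra! h
        exact hxR ⟨by linarith, by linarith⟩
      have h1 : (F x - F y) ^ 2 ≤ (u x - u y) ^ 2 := by
        rw [sq_le_sq]
        refine (abs_max_sub_max_le_abs _ _ _).trans (le_of_eq ?_)
        rw [sub_sub_sub_cancel_right]
      refine h1.trans ?_
      simp only [hv, if_pos hx, if_pos hy]
      refine hρ.exp_sub_exp_sq_le hdom (φ := fun y => -(a * max (ρ y x₀ - r) 0)) hxy ?_
      rw [neg_sub_neg, ← mul_sub, abs_mul, abs_of_pos ha]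
      refine mul_le_mul_of_nonneg_left ?_ ha.le
      refine (abs_max_sub_max_le_abs _ _ _).trans ?_
      rw [sub_sub_sub_cancel_right, abs_sub_comm]
      exact hρ.abs_sub_le x y x₀
  set U := ∑ y ∈ S, G.m y * u y ^ 2 with hU
  have hU0 : 0 ≤ U := Finset.sum_nonneg fun y _ => mul_nonneg (G.m_pos y).le (sq_nonneg _)
  have hE : G.energy F ≤ ENNReal.ofReal (t * U) := by
    refine (hρ.energy_le hv0 hdiff).trans (le_of_eq ?_)
    rw [tsum_eq_sum (s := S) fun y hy => by simp [hv, hy],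
      ← ENNReal.ofReal_sum_of_nonneg fun y _ => mul_nonneg (G.m_pos y).le (hv0 y), hU,
      Finset.mul_sum]
    congr 1
    refine Finset.sum_congr rfl fun y hy => ?_
    simp only [hv, if_pos hy]; ring
  have hmain := hform F hsupp (t * U) (by positivity) hE S
  have hKle : C * ∑ x ∈ K, G.m x * F x ^ 2 ≤ CK := by
    refine mul_le_mul_of_nonneg_left (Finset.sum_le_sum fun x _ => ?_) hC
    exact mul_le_of_le_one_right (G.m_pos x).le (pow_le_one₀ (hF0 x) (hF1 x))
  set Φ := ∑ x ∈ S, G.m x * F x ^ 2 with hΦ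
  set vS := ∑ x ∈ S, G.m x with hvS
  -- Young's inequality for `u ≤ F + ε`. The cutoff error carries the volume of the ball, and this
  -- is how `vS` enters.
  have hUle : U ≤ (1 + δ) * Φ + (1 + 1 / δ) * (ε ^ 2 * vS) := by
    rw [hU, hΦ, hvS, Finset.mul_sum, Finset.mul_sum, Finset.mul_sum, ← Finset.sum_add_distrib]
    refine Finset.sum_le_sum fun x _ => ?_
    have h1 : u x ≤ F x + ε := by linarith [le_max_left (u x - ε) 0]
    have h2 : u x ^ 2 ≤ (1 + δ) * F x ^ 2 + (1 + 1 / δ) * ε ^ 2 := by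
      have h3 : (1 + δ) * F x ^ 2 + (1 + 1 / δ) * ε ^ 2 - (F x + ε) ^ 2 =
          (δ * F x - ε) ^ 2 / δ := by field_simp; ring
      have h4 : 0 ≤ (δ * F x - ε) ^ 2 / δ := by positivity
      have h5 : u x ^ 2 ≤ (F x + ε) ^ 2 := by
        have := (hu0 x).le
        gcongr
      linarith
    have := mul_le_mul_of_nonneg_left h2 (G.m_pos x).le
    linarith
  have hΦlow : (CK + 1) / b ≤ Φ := by
    have h1 : ∑ x ∈ S₀, G.m x * (1 / 4) ≤ Φ := by
      rw [hΦ]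
      have hsub : S₀ ⊆ S := fun x hx => by rw [hmemS]; linarith [hr x hx]
      refine (Finset.sum_le_sum fun x hx => ?_).trans (Finset.sum_le_sum_of_subset_of_nonneg hsub
        fun x _ _ => mul_nonneg (G.m_pos x).le (sq_nonneg _))
      refine mul_le_mul_of_nonneg_left ?_ (G.m_pos x).le
      have hux : u x = 1 := by
        simp only [hu]
        rw [max_eq_right (by linarith [hr x hx]), mul_zero, neg_zero, Real.exp_zero]
      have hFx : 1 / 2 ≤ F x := by
        refine le_trans ?_ (le_max_left _ _)
        rw [hux]; linarith
      nlinarith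
    rw [← Finset.sum_mul] at h1
    have : (CK + 1) / b = 4 * (CK + 1) / b * (1 / 4) := by ring
    linarith
  have hbΦ : CK + 1 ≤ b * Φ := by
    rw [div_le_iff₀ hb] at hΦlow; linarith
  have hone : 1 ≤ C₂ * (ε ^ 2 * vS) := by
    have h1 := mul_le_mul_of_nonneg_left hUle ht0.le
    have h2 : t * ((1 + δ) * Φ + (1 + 1 / δ) * (ε ^ 2 * vS)) =
        (t + t') / 2 * Φ + C₂ * (ε ^ 2 * vS) := by rw [← htδ, hC2]; ring
    have h3 : b * Φ = t' * Φ - (t + t') / 2 * Φ := by rw [hbdef]; ring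
    linarith
  have hball : ball ρ x₀ R₁ = (S : Set V) := by rw [hS, Set.Finite.coe_toFinset]
  rw [hball, vol_coe_finset]
  refine ENNReal.ofReal_le_ofReal ?_
  have hexp : Real.exp (-(2 * a * (r + s))) * Real.exp (2 * a * R₁) * ε ^ 2 = 1 := by
    rw [hεdef, ← Real.exp_nat_mul, ← Real.exp_add, ← Real.exp_add, Real.exp_eq_one_iff, hRdef]
    push_cast; ring
  have hε2pos : 0 < ε ^ 2 := by positivity
  have hkey : C₂⁻¹ ≤ ε ^ 2 * vS := by
    rw [inv_le_iff_one_le_mul₀' hC2pos]; exact hone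
  refine le_of_mul_le_mul_right ?_ hε2pos
  calc C₂⁻¹ * Real.exp (-(2 * a * (r + s))) * Real.exp (2 * a * R₁) * ε ^ 2
      = C₂⁻¹ * (Real.exp (-(2 * a * (r + s))) * Real.exp (2 * a * R₁) * ε ^ 2) := by ring
    _ = C₂⁻¹ := by rw [hexp, mul_one]
    _ ≤ _ := by rw [mul_comm vS]; exact hkey

end WeightedGraph

/-! ### Finite volume: exponential decay of the complements of balls. -/

namespace WeightedGraph

variable {V : Type*} {G : WeightedGraph V} {ρ : V → V → ℝ}

theorem summable_m (h : G.vol Set.univ < ∞) : Summable G.m := by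
  rw [vol_univ] at h
  have := ENNReal.summable_toReal h.ne
  simpa [ENNReal.toReal_ofReal, (G.m_pos _).le] using this

theorem IsAdmissible.vol_compl_ball_le [Infinite V] (hρ : G.IsAdmissible ρ) (x₀ : V)
    (hvol : G.vol Set.univ < ∞) {t : ℝ} (ht0 : 0 < t) (ht : (t : EReal) < G.muE) :
    ∃ C : ℝ, 0 < C ∧ ∀ R : ℝ,
      G.vol (ball ρ x₀ R)ᶜ ≤ ENNReal.ofReal (C * Real.exp (-2 * G.rate ρ 0 t * R)) := by
  have hdom := mem_rateDomain hρ ht0 ht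
  have hs := hρ.jumpSize_pos x₀
  have ha := rate_pos hs hdom
  obtain ⟨t', htt', K, C, hC, hform⟩ := G.exists_form_bound ht0 ht
  set a := G.rate ρ 0 t with hadef
  have hm := summable_m hvol
  have hm0 : ∀ x, 0 ≤ G.m x := fun x => (G.m_pos x).le
  -- Bounds the term on `K` for all `R` at once, since `u ≤ e^{aρ}`; this makes the final constant
  -- independent of `R`.
  set D := ∑ x ∈ K, G.m x * Real.exp (a * ρ x x₀) ^ 2 with hD
  have hD0 : 0 ≤ D := Finset.sum_nonneg fun x _ => mul_nonneg (hm0 x) (sq_nonneg _)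
  have htt : 0 < t' - t := by linarith
  refine ⟨C * D / (t' - t) + 1, by positivity, fun R => ?_⟩
  set u : V → ℝ := fun y => Real.exp (a * min (ρ y x₀) R) with hu
  set M := Real.exp (a * R) with hM
  have hM0 : 0 < M := Real.exp_pos _
  have hu0 : ∀ y, 0 < u y := fun y => Real.exp_pos _
  have huM : ∀ y, u y ≤ M := fun y =>
    Real.exp_le_exp.2 (mul_le_mul_of_nonneg_left (min_le_right _ _) ha.le)
  have huρ : ∀ y, u y ≤ Real.exp (a * ρ y x₀) := fun y =>
    Real.exp_le_exp.2 (mul_le_mul_of_nonneg_left (min_le_left _ _) ha.le)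
  have hsumU : Summable fun y => G.m y * u y ^ 2 :=
    Summable.of_nonneg_of_le (fun y => mul_nonneg (hm0 y) (sq_nonneg _))
      (fun y => mul_le_mul_of_nonneg_left
        (pow_le_pow_left₀ (hu0 y).le (huM y) 2) (hm0 y)) (hm.mul_right (M ^ 2))
  set U := ∑' y, G.m y * u y ^ 2 with hU
  set W := ∑' y, G.m y with hW
  have hU0 : 0 ≤ U := tsum_nonneg fun y => mul_nonneg (hm0 y) (sq_nonneg _)
  have hW0 : 0 ≤ W := tsum_nonneg hm0
  have hstep : ∀ n : ℕ, 0 < n → ∀ S : Finset V, (∀ x ∈ S, ρ x x₀ ≤ n) →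
      t' * ∑ x ∈ S, G.m x * u x ^ 2 ≤ t * U + M ^ 2 / (2 * (n : ℝ) ^ 2) * W + C * D := by
    intro n hn S hSn
    have hn0 : (0 : ℝ) < n := Nat.cast_pos.2 hn
    -- A cutoff that is `M/n`-Lipschitz, at least `M ≥ u` on the ball of radius `n` and zero beyond
    -- `2n`. Taking the minimum with `u` costs energy at most `M² W / (2n²)`, which vanishes as `n →
    -- ∞` because the total mass `W` is finite.
    set η : V → ℝ := fun y => M * max (2 - ρ y x₀ / n) 0 with hη
    set F : V → ℝ := fun y => min (u y) (η y) with hF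
    have hη0 : ∀ y, 0 ≤ η y := fun y => mul_nonneg hM0.le (le_max_right _ _)
    have hF0 : ∀ y, 0 ≤ F y := fun y => le_min (hu0 y).le (hη0 y)
    have hFu : ∀ y, F y ≤ u y := fun y => min_le_left _ _
    have hsupp : (Function.support F).Finite := by
      refine (hρ.finite_ball x₀ (2 * n) (by positivity)).subset fun y hy => ?_
      by_contra hn'
      rw [mem_ball, not_le] at hn'
      refine hy ?_
      have : η y = 0 := by
        simp only [hη]
        rw [max_eq_right, mul_zero]
        rw [sub_nonpos, le_div_iff₀ hn0]; exact hn'.le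
      simp only [hF, this]
      exact min_eq_right (hu0 y).le
    set v : V → ℝ := fun y => t * u y ^ 2 + M ^ 2 / (2 * (n : ℝ) ^ 2) with hv
    have hv0 : ∀ y, 0 ≤ v y := fun y => by simp only [hv]; positivity
    have hdiff : ∀ x y, G.graph.Adj x y → (F x - F y) ^ 2 ≤ ρ x y ^ 2 * (v x + v y) := by
      intro x y hxy
      have hρxy := hρ.abs_sub_le x y x₀
      have h1 : (u x - u y) ^ 2 ≤ ρ x y ^ 2 * (t * u x ^ 2 + t * u y ^ 2) := by
        refine hρ.exp_sub_exp_sq_le hdom (φ := fun y => a * min (ρ y x₀) R) hxy ?_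
        rw [← mul_sub, abs_mul, abs_of_pos ha]
        refine mul_le_mul_of_nonneg_left ?_ ha.le
        exact (abs_min_sub_min_le_max _ _ _ _).trans
          (max_le hρxy (by rw [sub_self, abs_zero]; exact hρ.nonneg x y))
      have h2 : (η x - η y) ^ 2 ≤ ρ x y ^ 2 * (M ^ 2 / (n : ℝ) ^ 2) := by
        have h3 : |η x - η y| ≤ M * (ρ x y / n) := by
          simp only [hη]
          rw [← mul_sub, abs_mul, abs_of_pos hM0]
          refine mul_le_mul_of_nonneg_left ((abs_max_sub_max_le_abs _ _ _).trans ?_) hM0.le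
          rw [sub_sub_sub_cancel_left, ← sub_div, abs_div, abs_of_pos hn0, abs_sub_comm]
          gcongr
        calc (η x - η y) ^ 2 = |η x - η y| ^ 2 := (sq_abs _).symm
          _ ≤ (M * (ρ x y / n)) ^ 2 := by gcongr
          _ = _ := by ring
      have h3 : (F x - F y) ^ 2 ≤ (u x - u y) ^ 2 + (η x - η y) ^ 2 := by
        have h4 := abs_min_sub_min_le_max (u x) (η x) (u y) (η y)
        rcases le_max_iff.1 h4 with h | h
        · have := sq_le_sq.2 h
          linarith [sq_nonneg (η x - η y)]
        · have := sq_le_sq.2 h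
          linarith [sq_nonneg (u x - u y)]
      refine h3.trans ((add_le_add h1 h2).trans (le_of_eq ?_))
      simp only [hv]
      field_simp
      ring
    have hsumv : HasSum (fun y => G.m y * v y) (t * U + M ^ 2 / (2 * (n : ℝ) ^ 2) * W) := by
      have := (hsumU.hasSum.mul_left t).add
        (hm.hasSum.mul_left (M ^ 2 / (2 * (n : ℝ) ^ 2)))
      have he : (fun y => G.m y * v y) =
          fun y => t * (G.m y * u y ^ 2) + M ^ 2 / (2 * (n : ℝ) ^ 2) * G.m y := by
        ext y; simp only [hv]; ring
      rwa [he]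
    have hE : G.energy F ≤ ENNReal.ofReal (t * U + M ^ 2 / (2 * (n : ℝ) ^ 2) * W) := by
      refine (hρ.energy_le hv0 hdiff).trans (le_of_eq ?_)
      rw [← hsumv.tsum_eq, ENNReal.ofReal_tsum_of_nonneg
        (fun y => mul_nonneg (hm0 y) (hv0 y)) hsumv.summable]
    have hmain := hform F hsupp _ (by positivity) hE S
    have hFS : ∀ x ∈ S, G.m x * F x ^ 2 = G.m x * u x ^ 2 := by
      intro x hx
      have h1 : M ≤ η x := by
        simp only [hη]
        refine le_mul_of_one_le_right hM0.le (le_trans ?_ (le_max_left _ _))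
        have : ρ x x₀ / n ≤ 1 := by rw [div_le_one hn0]; exact hSn x hx
        linarith
      have h2 : F x = u x := min_eq_left ((huM x).trans h1)
      rw [h2]
    rw [Finset.sum_congr rfl hFS] at hmain
    refine hmain.trans (add_le_add_right (mul_le_mul_of_nonneg_left ?_ hC) _)
    refine Finset.sum_le_sum fun x _ => mul_le_mul_of_nonneg_left ?_ (hm0 x)
    exact pow_le_pow_left₀ (hF0 x) ((hFu x).trans (huρ x)) 2
  have hlim : ∀ S : Finset V, t' * ∑ x ∈ S, G.m x * u x ^ 2 ≤ t * U + C * D := by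
    intro S
    obtain ⟨r, hr0, hr⟩ := exists_forall_mem_finset_le ρ x₀ S
    have h1 : Tendsto (fun n : ℕ => t * U + M ^ 2 / (2 * (n : ℝ) ^ 2) * W + C * D) atTop
        (𝓝 (t * U + 0 * W + C * D)) := by
      refine (((Tendsto.const_div_atTop ?_ _).mul_const _).const_add _).add_const _
      exact Tendsto.const_mul_atTop two_pos
        ((tendsto_pow_atTop two_ne_zero).comp tendsto_natCast_atTop_atTop)
    rw [zero_mul, add_zero] at h1
    refine ge_of_tendsto h1 ?_
    filter_upwards [eventually_gt_atTop 0, eventually_ge_atTop ⌈r⌉₊] with n hn hnr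
    exact hstep n hn S fun x hx => (hr x hx).trans ((Nat.le_ceil r).trans (Nat.cast_le.2 hnr))
  have ht'0 : 0 < t' := ht0.trans htt'
  have hUle : U ≤ C * D / (t' - t) := by
    have h1 : U ≤ (t * U + C * D) / t' := by
      refine Real.tsum_le_of_sum_le (fun y => mul_nonneg (hm0 y) (sq_nonneg _)) fun S => ?_
      rw [le_div_iff₀ ht'0, mul_comm]; exact hlim S
    rw [le_div_iff₀ ht'0] at h1
    rw [le_div_iff₀ htt]; linarith
  rw [vol, tsum_subtype (ball ρ x₀ R)ᶜ fun x => ENNReal.ofReal (G.m x)]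
  calc ∑' x, (ball ρ x₀ R)ᶜ.indicator (fun x => ENNReal.ofReal (G.m x)) x
      ≤ ∑' x, ENNReal.ofReal (Real.exp (-2 * a * R) * (G.m x * u x ^ 2)) := by
        refine ENNReal.tsum_le_tsum fun x => ?_
        classical
        rw [Set.indicator_apply]
        split_ifs with hx
        swap
        · exact zero_le
        refine ENNReal.ofReal_le_ofReal (le_of_eq ?_)
        have hx : R < ρ x x₀ := not_le.1 hx
        have : Real.exp (-2 * a * R) * u x ^ 2 = 1 := by
          simp only [hu]
          rw [min_eq_right hx.le, ← Real.exp_nat_mul, ← Real.exp_add, Real.exp_eq_one_iff]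
          push_cast; ring
        linear_combination (-G.m x) * this
    _ = ENNReal.ofReal (Real.exp (-2 * a * R) * U) := by
        rw [← ENNReal.ofReal_tsum_of_nonneg, tsum_mul_left]
        · exact fun x => mul_nonneg (Real.exp_pos _).le (mul_nonneg (hm0 x) (sq_nonneg _))
        · exact hsumU.mul_left _
    _ ≤ _ := by
        refine ENNReal.ofReal_le_ofReal ?_
        rw [mul_comm]
        have := Real.exp_pos (-2 * a * R)
        gcongr
        linarith

/-! ### Volume entropy and inversion of the rate. -/

theorem strictMonoOn_rate (hs : 0 < G.jumpSize ρ) :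
    StrictMonoOn (G.rate ρ 0) (G.rateDomain ρ 0) := by
  intro p hp q hq hpq
  have hp0 : 0 < p := hp.1
  by_cases hd : ρ = G.combDist
  · have hq1 := hq.2 hd
    rw [rate, rate, if_pos hd, if_pos hd]
    simp only [sub_zero, div_one]
    have h1 : 0 < 1 - q := by linarith
    have h2 : 0 < 1 - p := by linarith
    refine add_lt_add_of_lt_of_le (Real.log_lt_log (by positivity) ?_)
      (Real.log_le_log (by positivity) ?_)
    · exact one_div_lt_one_div_of_lt h1 (by linarith)
    · gcongr
  · rw [rate, rate, if_neg hd, if_neg hd]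
    simp only [sub_zero]
    gcongr

theorem vol_lt_top_of_finite {S : Set V} (hS : S.Finite) : G.vol S < ∞ := by
  rw [← hS.coe_toFinset, vol_coe_finset]
  exact ENNReal.ofReal_lt_top

theorem vol_pos {S : Set V} (hS : S.Nonempty) : 0 < G.vol S := by
  obtain ⟨x, hx⟩ := hS
  refine lt_of_lt_of_le ?_ (ENNReal.le_tsum (⟨x, hx⟩ : S))
  exact ENNReal.ofReal_pos.2 (G.m_pos x)

theorem vol_mono {S T : Set V} (h : S ⊆ T) : G.vol S ≤ G.vol T :=
  ENNReal.tsum_mono_subtype (fun x => ENNReal.ofReal (G.m x)) h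

theorem tendsto_log_growth (C b : ℝ) :
    Tendsto (fun R : ℝ => ((1 / R * (C + b * R) : ℝ) : EReal)) atTop (𝓝 (b : EReal)) := by
  refine (continuous_coe_real_ereal.tendsto _).comp ?_
  have h1 : Tendsto (fun R : ℝ => C * R⁻¹ + b) atTop (𝓝 (C * 0 + b)) :=
    (tendsto_inv_atTop_zero.const_mul C).add_const b
  rw [mul_zero, zero_add] at h1
  refine h1.congr' ?_
  filter_upwards [eventually_gt_atTop 0] with R hR
  field_simp

theorem IsAdmissible.two_mul_rate_le_entropy [Infinite V] (hρ : G.IsAdmissible ρ) (x₀ : V)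
    {t : ℝ} (ht0 : 0 < t) (ht : (t : EReal) < G.muE) :
    ((2 * G.rate ρ 0 t : ℝ) : EReal) ≤ G.entropy ρ x₀ := by
  rw [entropy]
  split_ifs with hvol
  · obtain ⟨C, hC, hev⟩ := hρ.eventually_le_vol_ball x₀ hvol ht0 ht
    rw [← (tendsto_log_growth (Real.log C) (2 * G.rate ρ 0 t)).liminf_eq]
    refine liminf_le_liminf ?_
    filter_upwards [hev, eventually_gt_atTop 0] with R hR hR0
    rw [EReal.coe_le_coe_iff]
    have h1 := (ENNReal.ofReal_le_iff_le_toReal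
      (vol_lt_top_of_finite (hρ.finite_ball x₀ R hR0)).ne).1 hR
    have h2 := Real.log_le_log (by positivity) h1
    rw [Real.log_mul hC.ne' (Real.exp_pos _).ne', Real.log_exp] at h2
    gcongr
  · have hvol' : G.vol Set.univ < ∞ := lt_top_iff_ne_top.2 hvol
    obtain ⟨C, hC, hev⟩ := hρ.vol_compl_ball_le x₀ hvol' ht0 ht
    rw [← (tendsto_log_growth (-Real.log C) (2 * G.rate ρ 0 t)).liminf_eq]
    refine liminf_le_liminf ?_
    filter_upwards [eventually_gt_atTop 0] with R hR0
    rw [EReal.coe_le_coe_iff]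
    -- Positive volume of the complement rules out the default value `log 0 = 0`.
    have hne : ((ball ρ x₀ R)ᶜ).Nonempty := (hρ.finite_ball x₀ R hR0).infinite_compl.nonempty
    have hlt : G.vol (ball ρ x₀ R)ᶜ < ∞ := (vol_mono (Set.subset_univ _)).trans_lt hvol'
    have h0 := ENNReal.toReal_pos (vol_pos (G := G) hne).ne' hlt.ne
    have h1 := ENNReal.toReal_le_of_le_ofReal (by positivity) (hev R)
    have h2 := Real.log_le_log h0 h1
    rw [Real.log_mul hC.ne' (Real.exp_pos _).ne', Real.log_exp] at h2
    rw [← mul_neg]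
    gcongr
    linarith

theorem IsAdmissible.entropy_pos [Infinite V] (hρ : G.IsAdmissible ρ) (x₀ : V)
    (hμ : 0 < G.muE) : 0 < G.entropy ρ x₀ := by
  obtain ⟨t, ht0, ht⟩ := EReal.lt_iff_exists_real_btwn.1 hμ
  have ht0 : 0 < t := EReal.coe_pos.1 ht0
  refine lt_of_lt_of_le ?_ (hρ.two_mul_rate_le_entropy x₀ ht0 ht)
  rw [EReal.coe_pos]
  have := rate_pos (hρ.jumpSize_pos x₀) (mem_rateDomain hρ ht0 ht)
  positivity

theorem IsAdmissible.muE_le_rateInv [Infinite V] (hρ : G.IsAdmissible ρ) (x₀ : V)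
    (hμ : 0 < G.muE) : G.muE ≤ G.rateInv ρ (G.entropy ρ x₀ / 2) := by
  have hs := hρ.jumpSize_pos x₀
  by_contra! hlt
  -- A real `t` strictly between the claimed bound and `μ_e` contradicts `a_0(t) ≤ τ / 2` and
  -- monotonicity; for infinite entropy it contradicts `t` lying in the domain of `a_0`.
  obtain ⟨t, ht1, ht⟩ := EReal.lt_iff_exists_real_btwn.1 (max_lt hμ hlt)
  have ht0 : 0 < t := EReal.coe_pos.1 ((le_max_left _ _).trans_lt ht1)
  have ht1 := (le_max_right _ _).trans_lt ht1
  have hdom := mem_rateDomain hρ ht0 ht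
  rw [rateInv] at ht1
  split_ifs at ht1 with htop
  · exact absurd ht1 (not_lt.2 (le_sSup ⟨t, hdom, rfl⟩))
  · have hle : ((G.rate ρ 0 t : ℝ) : EReal) ≤ G.entropy ρ x₀ / 2 := by
      rw [EReal.le_div_iff_mul_le two_pos (by decide)]
      have := hρ.two_mul_rate_le_entropy x₀ ht0 ht
      rw [mul_comm] at this
      exact_mod_cast this
    have hbot : G.entropy ρ x₀ / 2 ≠ ⊥ := fun h => by
      rw [h, le_bot_iff] at hle
      exact EReal.coe_ne_bot _ hle
    set y := (G.entropy ρ x₀ / 2).toReal with hy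
    have hyE : (y : EReal) = G.entropy ρ x₀ / 2 := EReal.coe_toReal htop hbot
    rw [← hyE, EReal.coe_le_coe_iff] at hle
    have hy0 : 0 < y := (rate_pos hs hdom).trans_le hle
    have hsurj := (G.rate_bijOn ρ hs).surjOn (Set.mem_Ioi.2 hy0)
    have h1 := Function.invFunOn_mem hsurj
    have h2 := Function.invFunOn_eq hsurj
    rw [EReal.coe_lt_coe_iff] at ht1
    have h3 := strictMonoOn_rate hs h1 hdom ht1
    rw [h2] at h3
    linarith

end WeightedGraph

/-! ### Distances in trees. -/

namespace SimpleGraph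

variable {V : Type*} {T : SimpleGraph V}

theorem Connected.exists_adj_dist_eq (hT : T.Connected) {x o : V} {k : ℕ}
    (h : T.dist x o = k + 1) : ∃ y, T.Adj x y ∧ T.dist y o = k := by
  obtain ⟨p, hp⟩ := hT.exists_walk_length_eq_dist x o
  rw [h] at hp
  cases p with
  | nil => simp at hp
  | cons hxy p =>
    rename_i y
    refine ⟨y, hxy, le_antisymm ?_ ?_⟩
    · have := dist_le p
      rw [Walk.length_cons] at hp
      omega
    · have h1 := hT.dist_triangle (u := x) (v := y) (w := o)
      rw [dist_eq_one_iff_adj.2 hxy] at h1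
      omega

/-- A geodesic from `o` to a closer neighbour of `x` extends to the unique path from `o` to `x`, so
that neighbour is the penultimate vertex of this path. -/
theorem IsTree.eq_of_adj_of_dist_lt (hT : T.IsTree) {o x y z : V} (hy : T.Adj x y)
    (hz : T.Adj x z) (hyo : T.dist y o < T.dist x o) (hzo : T.dist z o < T.dist x o) : y = z := by
  have key : ∀ w, T.Adj x w → T.dist w o < T.dist x o →
      ∃ p : T.Walk o x, p.IsPath ∧ p.penultimate = w := by
    intro w hw hwo
    obtain ⟨p, hp⟩ := hT.connected.exists_walk_length_eq_dist o w
    refine ⟨p.concat hw.symm, Walk.isPath_of_length_eq_dist _ ?_, Walk.penultimate_concat _ _⟩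
    have h1 := hT.dist_eq_dist_add_one_of_adj o hw
    rw [dist_comm (u := o) (v := x), dist_comm (u := o) (v := w)] at h1
    rw [Walk.length_concat, hp, dist_comm (u := o) (v := x), dist_comm (u := o) (v := w)]
    omega
  obtain ⟨p, hp, hpy⟩ := key y hy hyo
  obtain ⟨r, hr, hrz⟩ := key z hz hzo
  have := (hT.existsUnique_path o x).unique hp hr
  rw [← hpy, ← hrz, this]

end SimpleGraph

/-! ### Sharpness on the regular tree. -/

namespace WeightedGraph

variable {V : Type*} {G : WeightedGraph V}

/-- A lower bound of the energy by means of a positive function `h`, with `k x y = h y / h x`. -/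
theorem tsum_sq_le_energy_add {k : V → V → ℝ} (hk0 : ∀ x y, 0 < k x y)
    (hk : ∀ x y, G.graph.Adj x y → k x y * k y x = 1) (f : V → ℝ) :
    ∑' x, (∑' y, ENNReal.ofReal (G.w x y)) * ENNReal.ofReal (f x ^ 2) ≤
      G.energy f + ∑' x, (∑' y, ENNReal.ofReal (G.w x y * k x y)) * ENNReal.ofReal (f x ^ 2) := by
  have hpt : ∀ x y, ENNReal.ofReal (G.w x y) * ENNReal.ofReal (f x ^ 2) +
      ENNReal.ofReal (G.w y x) * ENNReal.ofReal (f y ^ 2) ≤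
      ENNReal.ofReal (G.w x y * (f x - f y) ^ 2) +
      (ENNReal.ofReal (G.w x y * k x y) * ENNReal.ofReal (f x ^ 2) +
      ENNReal.ofReal (G.w y x * k y x) * ENNReal.ofReal (f y ^ 2)) := by
    intro x y
    have hw := G.w_nonneg x y
    have hkx := (hk0 x y).le
    have hky := (hk0 y x).le
    rw [G.w_symm y x, ← ENNReal.ofReal_mul hw, ← ENNReal.ofReal_mul hw,
      ← ENNReal.ofReal_mul (by positivity), ← ENNReal.ofReal_mul (by positivity),
      ← ENNReal.ofReal_add (by positivity) (by positivity),
      ← ENNReal.ofReal_add (by positivity) (by positivity),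
      ← ENNReal.ofReal_add (by positivity) (by positivity)]
    refine ENNReal.ofReal_le_ofReal ?_
    by_cases hxy : G.graph.Adj x y
    · have h1 := hk x y hxy
      -- Weighted AM–GM for the cross term of `(f x - f y)²`.
      have h2 : 2 * (f x * f y) ≤ k x y * f x ^ 2 + k y x * f y ^ 2 := by
        have h3 : 0 ≤ k y x * (k x y * f x - f y) ^ 2 := by positivity
        have h4 : k y x * (k x y * f x - f y) ^ 2 =
            (k x y * k y x) * (k x y * f x ^ 2 - 2 * (f x * f y)) + k y x * f y ^ 2 := by ring
        rw [h4, h1] at h3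
        linarith
      have := mul_le_mul_of_nonneg_left h2 hw
      linarith
    · simp [G.w_zero x y hxy]
  have hsum : ∀ F : V → V → ℝ≥0∞, ∑' x, ∑' y, (F x y * ENNReal.ofReal (f x ^ 2) +
      F y x * ENNReal.ofReal (f y ^ 2)) = 2 * ∑' x, (∑' y, F x y) * ENNReal.ofReal (f x ^ 2) := by
    intro F
    simp only [ENNReal.tsum_add]
    conv_lhs => rw [add_comm, ENNReal.tsum_comm, ← two_mul]
    simp only [ENNReal.tsum_mul_right]
  have hle := ENNReal.tsum_le_tsum fun x => ENNReal.tsum_le_tsum fun y => hpt x y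
  rw [hsum] at hle
  simp only [ENNReal.tsum_add (f := fun y => ENNReal.ofReal (G.w _ y * (f _ - f y) ^ 2))] at hle
  rw [ENNReal.tsum_add, hsum fun x y => ENNReal.ofReal (G.w x y * k x y)] at hle
  have hE : ∑' x, ∑' y, ENNReal.ofReal (G.w x y * (f x - f y) ^ 2) = 2 * G.energy f := by
    rw [energy, ENNReal.mul_div_cancel two_ne_zero ENNReal.ofNat_ne_top]
  rw [hE, ← mul_add] at hle
  exact (ENNReal.mul_le_mul_iff_right two_ne_zero ENNReal.ofNat_ne_top).1 hle

/-- The neighbours of a vertex. -/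
noncomputable def neighbors (G : WeightedGraph V) (x : V) : Finset V :=
  (G.finite_neighborSet x).toFinset

theorem mem_neighbors {x y : V} : y ∈ G.neighbors x ↔ G.graph.Adj x y := by
  simp [neighbors]

namespace IsRegularTree

variable {N : ℕ}

theorem card_neighbors (h : G.IsRegularTree N) (x : V) : (G.neighbors x).card = N := by
  rw [← h.regular x, neighbors, Set.ncard_eq_toFinset_card _ (G.finite_neighborSet x)]

theorem tsum_w_mul (h : G.IsRegularTree N) (x : V) {k : V → ℝ} (hk : ∀ y, 0 ≤ k y) :
    ∑' y, ENNReal.ofReal (G.w x y * k y) = ENNReal.ofReal (∑ y ∈ G.neighbors x, k y) := by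
  rw [tsum_eq_sum (s := G.neighbors x), ENNReal.ofReal_sum_of_nonneg fun y _ => hk y]
  · refine Finset.sum_congr rfl fun y hy => ?_
    rw [h.w_eq x y (mem_neighbors.1 hy), one_mul]
  · intro y hy
    rw [mem_neighbors] at hy
    simp [G.w_zero x y hy]

/-- The terms are the ratios `h y / h x` for `h = (N-1)^{-d(·, o)/2}`. With `r = √(N-1)`, away from
`o` one closer neighbour gives `r` and the other `N - 1 = r²` give `1/r` each, in total `2r`; at `o`
the sum is smaller. -/
theorem sum_neighbors_le (h : G.IsRegularTree N) (hN : 2 ≤ N) (o x : V) :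
    ∑ y ∈ G.neighbors x, (if G.graph.dist y o < G.graph.dist x o then √((N : ℝ) - 1)
      else (√((N : ℝ) - 1))⁻¹) ≤ 2 * √((N : ℝ) - 1) := by
  classical
  have hN' : (2 : ℝ) ≤ N := by exact_mod_cast hN
  set r := √((N : ℝ) - 1) with hr
  have hr2 : r ^ 2 = N - 1 := Real.sq_sqrt (by linarith)
  have hr1 : 1 ≤ r := Real.one_le_sqrt.2 (by linarith)
  have hr0 : 0 < r := by linarith
  rw [Finset.sum_ite, Finset.sum_const, Finset.sum_const, nsmul_eq_mul, nsmul_eq_mul]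
  set A := (G.neighbors x).filter fun y => G.graph.dist y o < G.graph.dist x o with hA
  have hcard := Finset.card_filter_add_card_filter_not (s := G.neighbors x)
    (fun y => G.graph.dist y o < G.graph.dist x o)
  rw [h.card_neighbors, ← hA] at hcard
  have hA1 : A.card ≤ 1 := by
    rw [Finset.card_le_one]
    intro y hy z hz
    rw [hA, Finset.mem_filter, mem_neighbors] at hy hz
    exact h.isTree.eq_of_adj_of_dist_lt hy.1 hz.1 hy.2 hz.2
  set B := (G.neighbors x).filter fun y => ¬ G.graph.dist y o < G.graph.dist x o with hB
  have hcard' : (A.card : ℝ) + B.card = N := by exact_mod_cast hcard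
  have hA1' : (A.card : ℝ) ≤ 1 := by exact_mod_cast hA1
  have hBe : (B.card : ℝ) = r ^ 2 + 1 - A.card := by linarith
  rw [hBe]
  have : (A.card : ℝ) * r + (r ^ 2 + 1 - A.card) * r⁻¹ =
      2 * r - (1 - A.card) * (r ^ 2 - 1) * r⁻¹ := by field_simp; ring
  rw [this]
  have : 0 ≤ (1 - A.card) * (r ^ 2 - 1) * r⁻¹ :=
    mul_nonneg (mul_nonneg (by linarith) (by nlinarith)) (by positivity)
  linarith

theorem energy_ge (h : G.IsRegularTree N) (hN : 2 ≤ N) (o : V) {f : V → ℝ}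
    (hf : (Function.support f).Finite) :
    ENNReal.ofReal (1 - 2 * √((N : ℝ) - 1) / N) * G.normSq f ≤ G.energy f := by
  have hN' : (2 : ℝ) ≤ N := by exact_mod_cast hN
  set r := √((N : ℝ) - 1) with hr
  have hr2 : r ^ 2 = N - 1 := Real.sq_sqrt (by linarith)
  have hr1 : 1 ≤ r := Real.one_le_sqrt.2 (by linarith)
  have hr0 : 0 < r := by linarith
  set k : V → V → ℝ := fun x y =>
    if G.graph.dist y o < G.graph.dist x o then r else r⁻¹ with hk
  have hk0 : ∀ x y, 0 < k x y := fun x y => by simp only [hk]; split_ifs <;> positivity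
  have hk1 : ∀ x y, G.graph.Adj x y → k x y * k y x = 1 := by
    intro x y hxy
    have hne := h.isTree.dist_ne_of_adj o hxy
    rw [SimpleGraph.dist_comm (u := o) (v := x), SimpleGraph.dist_comm (u := o) (v := y)] at hne
    simp only [hk]
    rcases lt_or_gt_of_ne hne with hlt | hlt
    · rw [if_neg hlt.not_gt, if_pos hlt, inv_mul_cancel₀ hr0.ne']
    · rw [if_neg hlt.not_gt, if_pos hlt, mul_inv_cancel₀ hr0.ne']
  have hmain := tsum_sq_le_energy_add hk0 hk1 f
  have h1 : ∀ x, ∑' y, ENNReal.ofReal (G.w x y) = ENNReal.ofReal N := fun x => by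
    have := h.tsum_w_mul x (k := fun _ => 1) fun _ => zero_le_one
    simpa [h.card_neighbors] using this
  have h2 : ∀ x, ∑' y, ENNReal.ofReal (G.w x y * k x y) ≤ ENNReal.ofReal (2 * r) := fun x => by
    rw [h.tsum_w_mul x fun y => (hk0 x y).le]
    exact ENNReal.ofReal_le_ofReal (h.sum_neighbors_le hN o x)
  set Q := ∑' x, ENNReal.ofReal (f x ^ 2) with hQ
  have hQtop : Q ≠ ∞ := by
    rw [hQ, tsum_eq_sum (s := hf.toFinset)]
    · exact (ENNReal.sum_lt_top.2 fun _ _ => ENNReal.ofReal_lt_top).ne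
    · intro p hp
      have : f p = 0 := by simpa using hp
      simp [this]
  have hnorm : G.normSq f = ENNReal.ofReal N * Q := by
    rw [normSq, hQ, ← ENNReal.tsum_mul_left]
    refine tsum_congr fun x => ?_
    rw [h.m_eq, ENNReal.ofReal_mul (by positivity)]
  simp only [h1] at hmain
  rw [ENNReal.tsum_mul_left] at hmain
  have h3 : ENNReal.ofReal N * Q ≤ G.energy f + ENNReal.ofReal (2 * r) * Q := by
    refine hmain.trans (add_le_add le_rfl ?_)
    rw [hQ, ← ENNReal.tsum_mul_left]
    exact ENNReal.tsum_le_tsum fun x => mul_le_mul_left (h2 x) _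
  have h4 : ENNReal.ofReal N = ENNReal.ofReal (N - 2 * r) + ENNReal.ofReal (2 * r) := by
    rw [← ENNReal.ofReal_add (by nlinarith [sq_nonneg (r - 1)]) (by positivity)]
    congr 1; ring
  rw [h4, add_mul] at h3
  have h5 := ENNReal.le_of_add_le_add_right
    (ENNReal.mul_ne_top ENNReal.ofReal_ne_top hQtop) h3
  rw [hnorm, ← mul_assoc, ← ENNReal.ofReal_mul']
  · rwa [show (1 - 2 * r / (N : ℝ)) * N = N - 2 * r by field_simp]
  · positivity

theorem le_muE (h : G.IsRegularTree N) (hN : 2 ≤ N) (o : V) :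
    ((1 - 2 * √((N : ℝ) - 1) / N : ℝ) : EReal) ≤ G.muE := by
  have hN' : (2 : ℝ) ≤ N := by exact_mod_cast hN
  have hr2 : √((N : ℝ) - 1) ^ 2 = N - 1 := Real.sq_sqrt (by linarith)
  refine le_sInf ?_
  rintro _ ⟨t, ht, rfl⟩
  rw [EReal.coe_le_coe_iff]
  by_contra! hlt
  refine ht.1 (G.mem_resolventSet_of_energy_ge ?_ hlt fun f hf => h.energy_ge hN o hf)
  rw [sub_nonneg, div_le_one (by linarith)]
  nlinarith [sq_nonneg (√((N : ℝ) - 1) - 1)]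

open Classical in
theorem exists_sphere (h : G.IsRegularTree N) (o : V) (k : ℕ) :
    ∃ S : Finset V, (∀ y, y ∈ S ↔ G.graph.dist y o = k + 1) ∧ S.card ≤ N * (N - 1) ^ k := by
  induction k with
  | zero =>
    refine ⟨G.neighbors o, fun y => ?_, by rw [h.card_neighbors]; simp⟩
    rw [mem_neighbors, zero_add, SimpleGraph.dist_eq_one_iff_adj, SimpleGraph.adj_comm]
  | succ k ih =>
    obtain ⟨S, hS, hcard⟩ := ih
    refine ⟨S.biUnion fun x => (G.neighbors x).filter fun y => G.graph.dist y o = k + 1 + 1,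
      fun y => ?_, ?_⟩
    · rw [Finset.mem_biUnion]
      constructor
      · rintro ⟨x, -, hx⟩
        exact (Finset.mem_filter.1 hx).2
      · intro hy
        obtain ⟨x, hyx, hx⟩ := G.connected.exists_adj_dist_eq hy
        exact ⟨x, (hS x).2 hx, Finset.mem_filter.2 ⟨mem_neighbors.2 hyx.symm, hy⟩⟩
    · refine (Finset.card_biUnion_le_card_mul _ _ (N - 1) fun x hx => ?_).trans ?_
      · obtain ⟨z, hxz, hz⟩ := G.connected.exists_adj_dist_eq ((hS x).1 hx)
        have hlt : ((G.neighbors x).filter fun y => G.graph.dist y o = k + 1 + 1).card <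
            (G.neighbors x).card := by
          refine Finset.card_lt_card (Finset.filter_ssubset.2 ⟨z, mem_neighbors.2 hxz, ?_⟩)
          omega
        rw [h.card_neighbors] at hlt
        omega
      · rw [pow_succ, ← mul_assoc]
        exact Nat.mul_le_mul_right _ hcard

open Classical in
theorem exists_ball (h : G.IsRegularTree N) (hN : 3 ≤ N) (o : V) (k : ℕ) :
    ∃ B : Finset V, (∀ y, y ∈ B ↔ G.graph.dist y o ≤ k) ∧ B.card ≤ 4 * (N - 1) ^ k := by
  induction k with
  | zero =>
    refine ⟨{o}, fun y => ?_, by simp⟩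
    rw [Finset.mem_singleton, Nat.le_zero, G.connected.dist_eq_zero_iff]
  | succ k ih =>
    obtain ⟨B, hB, hcard⟩ := ih
    obtain ⟨S, hS, hScard⟩ := h.exists_sphere o k
    refine ⟨B ∪ S, fun y => ?_, ?_⟩
    · rw [Finset.mem_union, hB, hS]; omega
    · refine (Finset.card_union_le _ _).trans ((add_le_add hcard hScard).trans ?_)
      rw [pow_succ, ← add_mul, mul_comm ((N - 1) ^ k), ← mul_assoc]
      -- The constant 4 works because `4 + N ≤ 4 (N - 1)` for `N ≥ 3`.
      exact Nat.mul_le_mul_right _ (by omega)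

theorem exists_finset_ball (h : G.IsRegularTree N) (hN : 3 ≤ N) (o : V) {R : ℝ} (hR : 0 ≤ R) :
    ∃ B : Finset V, ball G.combDist o R = B ∧ (B.card : ℝ) ≤ 4 * Real.exp (Real.log (N - 1) * R) := by
  have hN' : (3 : ℝ) ≤ N := by exact_mod_cast hN
  obtain ⟨B, hB, hcard⟩ := h.exists_ball hN o ⌊R⌋₊
  refine ⟨B, ?_, ?_⟩
  · ext y
    rw [mem_ball, combDist, Finset.mem_coe, hB, Nat.le_floor_iff hR]
  · have h1 : (B.card : ℝ) ≤ 4 * ((N : ℝ) - 1) ^ ⌊R⌋₊ := by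
      have : (B.card : ℝ) ≤ ((4 * (N - 1) ^ ⌊R⌋₊ : ℕ) : ℝ) := by exact_mod_cast hcard
      push_cast [Nat.cast_sub (show 1 ≤ N by omega)] at this
      exact this
    refine h1.trans ?_
    rw [← Real.rpow_def_of_pos (by linarith), ← Real.rpow_natCast]
    gcongr
    · linarith
    · exact Nat.floor_le hR

theorem isAdmissible (h : G.IsRegularTree N) (hN : 3 ≤ N) : G.IsAdmissible G.combDist where
  nonneg x y := Nat.cast_nonneg _
  self x := by simp [combDist]
  symm x y := by rw [combDist, combDist, SimpleGraph.dist_comm]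
  triangle x y z := by
    have := G.connected.dist_triangle (u := x) (v := y) (w := z)
    simp only [combDist]
    exact_mod_cast this
  intrinsic x := by
    rw [tsum_eq_sum (s := G.neighbors x), h.m_eq, Finset.sum_congr rfl (g := fun _ => (1 : ℝ))]
    · rw [Finset.sum_const, h.card_neighbors]; simp
    · intro y hy
      rw [mem_neighbors] at hy
      rw [h.w_eq x y hy, combDist_of_adj hy]; norm_num
    · intro y hy
      rw [mem_neighbors] at hy
      rw [G.w_zero x y hy, zero_mul]
  finite_ball x R hR := by
    obtain ⟨B, hB, -⟩ := h.exists_finset_ball hN x hR.le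
    rw [hB]; exact B.finite_toSet
  finite_jump := by
    refine ⟨1, ?_⟩
    rintro _ ⟨x, y, hxy, rfl⟩
    rw [combDist_of_adj hxy]

theorem vol_univ_eq_top [Infinite V] (h : G.IsRegularTree N) (hN : 3 ≤ N) :
    G.vol Set.univ = ∞ := by
  rw [vol_univ]
  simp only [h.m_eq]
  refine ENNReal.tsum_const_eq_top_of_ne_zero ?_
  simp only [ne_eq, ENNReal.ofReal_eq_zero, not_le, Nat.cast_pos]
  omega

theorem entropy_le [Infinite V] (h : G.IsRegularTree N) (hN : 3 ≤ N) (o : V) :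
    G.entropy G.combDist o ≤ (Real.log ((N : ℝ) - 1) : EReal) := by
  have hN' : (3 : ℝ) ≤ N := by exact_mod_cast hN
  rw [entropy, if_pos (h.vol_univ_eq_top hN),
    ← (tendsto_log_growth (Real.log (4 * N)) (Real.log ((N : ℝ) - 1))).liminf_eq]
  refine liminf_le_liminf ?_
  filter_upwards [eventually_gt_atTop 0] with R hR
  rw [EReal.coe_le_coe_iff]
  obtain ⟨B, hB, hcard⟩ := h.exists_finset_ball hN o hR.le
  have hne : (ball G.combDist o R).Nonempty :=
    ⟨o, by rw [mem_ball, (h.isAdmissible hN).self]; exact hR.le⟩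
  have hpos : 0 < (G.vol (ball G.combDist o R)).toReal :=
    ENNReal.toReal_pos (vol_pos hne).ne'
      (vol_lt_top_of_finite ((h.isAdmissible hN).finite_ball o R hR)).ne
  have hle : (G.vol (ball G.combDist o R)).toReal ≤
      4 * N * Real.exp (Real.log (N - 1) * R) := by
    rw [hB, vol_coe_finset, ENNReal.toReal_ofReal (Finset.sum_nonneg fun x _ => (G.m_pos x).le),
      Finset.sum_congr rfl fun x _ => h.m_eq x, Finset.sum_const, nsmul_eq_mul]
    calc (B.card : ℝ) * N ≤ 4 * Real.exp (Real.log (N - 1) * R) * N := by gcongr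
      _ = _ := by ring
  have h2 := Real.log_le_log hpos hle
  rw [Real.log_mul (by positivity) (Real.exp_pos _).ne', Real.log_exp] at h2
  gcongr

theorem rate_eq (h : G.IsRegularTree N) [Infinite V] (hN : 3 ≤ N) (o : V) :
    (1 - 2 * √((N : ℝ) - 1) / N) ∈ G.rateDomain G.combDist 0 ∧
      G.rate G.combDist 0 (1 - 2 * √((N : ℝ) - 1) / N) = Real.log ((N : ℝ) - 1) / 2 := by
  have hN' : (3 : ℝ) ≤ N := by exact_mod_cast hN
  set r := √((N : ℝ) - 1) with hr
  have hr2 : r ^ 2 = N - 1 := Real.sq_sqrt (by linarith)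
  have hr1 : 1 < r := by rw [hr, Real.lt_sqrt zero_le_one]; linarith
  have hr0 : 0 < r := by linarith
  have hNr : (N : ℝ) = 1 + r ^ 2 := by linarith
  have ht0 : 0 < 1 - 2 * r / N := by
    rw [sub_pos, div_lt_one (by linarith), hNr]
    nlinarith [mul_pos (sub_pos.2 hr1) (sub_pos.2 hr1)]
  have ht1 : 1 - 2 * r / N < 1 := by
    have : 0 < 2 * r / N := by positivity
    linarith
  have hdom : (1 - 2 * r / N) ∈ G.rateDomain G.combDist 0 := ⟨ht0, fun _ => ht1⟩
  refine ⟨hdom, ?_⟩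
  have hE := exp_rate_combDist (G := G) ht0 ht1
  have hE1 := Real.one_lt_exp_iff.2 (rate_pos ((h.isAdmissible hN).jumpSize_pos o) hdom)
  rw [sub_sub_cancel] at hE
  set a := G.rate G.combDist 0 (1 - 2 * r / N) with ha
  set E := Real.exp a with hEdef
  -- With `1 - t = 2r / N` and `N = 1 + r²`, the quadratic equation for `E = e^a` has the roots `r`
  -- and `1/r`; `E > 1` selects `r = √(N-1)`.
  have hfac : (E - r) * (r * E - 1) = 0 := by
    have h1 : 2 * r / N * (1 + E ^ 2) * N = 2 * E * N := by rw [hE]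
    have h2 : 2 * r / N * (1 + E ^ 2) * N = 2 * r * (1 + E ^ 2) := by field_simp
    rw [h2, hNr] at h1
    linear_combination h1 / 2
  have hEr : E = r := by
    rcases mul_eq_zero.1 hfac with h1 | h1
    · linarith
    · nlinarith
  rw [← Real.log_exp a, ← hEdef, hEr, hr, Real.log_sqrt (by linarith)]

theorem muE_entropy_eq [Infinite V] (h : G.IsRegularTree N) (hN : 3 ≤ N) (o : V) :
    G.muE = ((1 - 2 * √((N : ℝ) - 1) / N : ℝ) : EReal) ∧
      G.entropy G.combDist o = (Real.log ((N : ℝ) - 1) : EReal) ∧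
      G.muE = G.rateInv G.combDist (G.entropy G.combDist o / 2) := by
  have hρ := h.isAdmissible hN
  have hs := hρ.jumpSize_pos o
  obtain ⟨hdom, hrate⟩ := h.rate_eq hN o
  have hle := h.le_muE (by omega) o
  set l := 1 - 2 * √((N : ℝ) - 1) / N with hl
  have hμ : 0 < G.muE := lt_of_lt_of_le (EReal.coe_pos.2 hdom.1) hle
  have hup := hρ.muE_le_rateInv o hμ
  have hent := h.entropy_le hN o
  have hent0 := hρ.entropy_pos o hμ
  obtain ⟨e, he⟩ : ∃ e : ℝ, G.entropy G.combDist o = e := by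
    refine ⟨(G.entropy G.combDist o).toReal, (EReal.coe_toReal ?_ ?_).symm⟩
    · exact (hent.trans_lt (EReal.coe_lt_top _)).ne
    · exact (bot_lt_iff_ne_bot.1 (EReal.bot_lt_zero.trans hent0))
  rw [he] at hup hent hent0 ⊢
  rw [EReal.coe_le_coe_iff] at hent
  have he0 : 0 < e := EReal.coe_pos.1 hent0
  have hhalf : (e : EReal) / 2 = ((e / 2 : ℝ) : EReal) := by
    rw [EReal.coe_div]; rfl
  have hinv : G.rateInv G.combDist ((e : EReal) / 2) =
      ((Function.invFunOn (G.rate G.combDist 0) (G.rateDomain G.combDist 0) (e / 2) : ℝ) :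
        EReal) := by
    rw [rateInv, hhalf, if_neg (EReal.coe_ne_top _), EReal.toReal_coe]
  have hsurj := (G.rate_bijOn G.combDist hs).surjOn (Set.mem_Ioi.2 (half_pos he0))
  have h1 := Function.invFunOn_mem hsurj
  have h2 := Function.invFunOn_eq hsurj
  rw [hinv] at hup ⊢
  set τ := Function.invFunOn (G.rate G.combDist 0) (G.rateDomain G.combDist 0) (e / 2) with hτ
  have hlτ : l ≤ τ := EReal.coe_le_coe_iff.1 (hle.trans hup)
  -- Applying `a_0` to `l ≤ μ_e ≤ a_0⁻¹(e / 2)` gives `log (N - 1) ≤ e`. The lower bound on the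
  -- entropy thus comes from the general inequality, not from counting.
  have h3 := (strictMonoOn_rate hs).monotoneOn hdom h1 hlτ
  rw [h2, hrate] at h3
  have hee : e = Real.log ((N : ℝ) - 1) := le_antisymm hent (by linarith)
  have hτl : τ = l := (strictMonoOn_rate hs).injOn h1 hdom (by rw [h2, hrate, hee])
  rw [hτl] at hup ⊢
  have := le_antisymm hup hle
  exact ⟨this, by rw [hee], this⟩

end IsRegularTree

end WeightedGraph

theorem mainTheorem5 {V : Type*} [Infinite V] (G : WeightedGraph V) (x₀ : V) :
    (∀ ρ : V → V → ℝ, G.IsAdmissible ρ → 0 < G.muE →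
      (∀ t : ℝ, 0 < t → (t : EReal) < G.muE →
        t ∈ G.rateDomain ρ 0 ∧
        (G.vol Set.univ = ∞ → ∃ C : ℝ, 0 < C ∧ ∀ᶠ R : ℝ in atTop,
          ENNReal.ofReal (C * Real.exp (2 * G.rate ρ 0 t * R)) ≤
            G.vol (WeightedGraph.ball ρ x₀ R)) ∧
        (G.vol Set.univ < ∞ → ∃ C : ℝ, 0 < C ∧ ∀ᶠ R : ℝ in atTop,
          G.vol (WeightedGraph.ball ρ x₀ R)ᶜ ≤
            ENNReal.ofReal (C * Real.exp (-2 * G.rate ρ 0 t * R)))) ∧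
      0 < G.entropy ρ x₀ ∧
      G.muE ≤ G.rateInv ρ (G.entropy ρ x₀ / 2)) ∧
    (∀ N : ℕ, 3 ≤ N → G.IsRegularTree N →
      G.muE = ((1 - 2 * √((N : ℝ) - 1) / N : ℝ) : EReal) ∧
      G.entropy G.combDist x₀ = (Real.log ((N : ℝ) - 1) : EReal) ∧
      G.muE = G.rateInv G.combDist (G.entropy G.combDist x₀ / 2)) := by
  refine ⟨fun ρ hρ hμ => ⟨fun t ht0 ht => ⟨WeightedGraph.mem_rateDomain hρ ht0 ht,
    fun hvol => hρ.eventually_le_vol_ball x₀ hvol ht0 ht, fun hvol => ?_⟩,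
    hρ.entropy_pos x₀ hμ, hρ.muE_le_rateInv x₀ hμ⟩,
    fun N hN h => h.muE_entropy_eq hN x₀⟩
  obtain ⟨C, hC, hle⟩ := hρ.vol_compl_ball_le x₀ hvol ht0 ht
  exact ⟨C, hC, Eventually.of_forall hle⟩
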